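/- Let $(M_1,g_1)$ and $(M_2,g_2)$ be smooth (finite-dimensional) Riemannian manifolds and let $k:M_1\to\mathbb R$ be a smooth function with $\inf_{M_1}k>0$. On $M=M_1\times M_2$ consider the semi-Riemannian warped product metric $g=g_1-k\,g_2$. Put $k_1=-1/\sup_{M_1}k$ if $k$ is bounded from above and $k_1=0$ otherwise, and for $r>k_1$ put $G_r=(\tfrac1k+r)\,g_1$, so that $G_r+g_2$ is a Riemannian metric on $M$. A curve $(\gamma,\tau):[0,1]\to M$ is called a Riemannian geodesic of $g$ with parameter $r$ if it is a geodesic of $g$ and there are a geodesic $(\tilde\mu,\tilde\nu):[0,1]\to M$ of $G_r+g_2$, constants $a,b\in\mathbb R$ and diffeomorphisms $\varphi,\psi:[0,1]\to[0,1]$ fixing $0$ and $1$ such that $\gamma=\tilde\mu\circ\varphi$, $\tau=\tilde\nu\circ\psi$, $$\varphi'=a\,\frac{1+rk}{k}\circ\tilde\mu\circ\varphi,\qquad \psi'=\frac{b}{k\circ\gamma},$$ $$a^2\,\frac{1+rk(x_0)}{k(x_0)}\,g_1(\dot{\tilde\mu}(0),\dot{\tilde\mu}(0))=b^2\,g_2(\dot{\tilde\nu}(0),\dot{\tilde\nu}(0)),\qquad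 x_0=\tilde\mu(0).$$ Let $r>k_1$ and let $(\mu,\nu):\mathbb R\to M$ be a geodesic of $G_r+g_2$. 1. Suppose that $\nu$ is not constant, or that $\mu$ is constant. Then for every $\alpha\in\mathbb R$ there is a real number $\beta\ge 0$, with $\beta>0$ if $\alpha\neq0$ and $\mu$ is not constant, such that $(\mu(0),\nu(0))$ is joined to each of the points $(\mu(\alpha),\nu(\beta))$ and $(\mu(\alpha),\nu(-\beta))$ by a Riemannian geodesic of $g$ with parameter $r$. 2. Suppose that $k$ is bounded from above, and that $\mu$ is not constant or $\nu$ is constant. Then for every $\beta\in\mathbb R$ there are real numbers $\alpha_1\ge0$ and $\alpha_2\le0$, with $\alpha_1>0>\alpha_2$ if $\beta\ne0$ and $\nu$ is not constant, such that $(\mu(0),\nu(0))$ is joined to each of the points $(\mu(\alpha_1),\nu(\beta))$ and $(\mu(\alpha_2),\nu(\beta))$ by a Riemannian geodesic of $g$ with parameter $r$. -/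

import Mathlib

open Set
open scoped Manifold ContDiff

noncomputable section

/-- A field of bilinear forms on the tangent spaces of `M`: a (0,2)-tensor field. -/
abbrev TensorField02 {E H : Type*} [NormedAddCommGroup E] [NormedSpace ℝ E] [TopologicalSpace H]
    (I : ModelWithCorners ℝ E H) (M : Type*) [TopologicalSpace M] [ChartedSpace H M] : Type _ :=
  ∀ x : M, LinearMap.BilinForm ℝ (TangentSpace I x)

section Geodesic

variable {E H : Type*} [NormedAddCommGroup E] [NormedSpace ℝ E] [TopologicalSpace H]
  {I : ModelWithCorners ℝ E H} {M : Type*} [TopologicalSpace M] [ChartedSpace H M]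

/-- The components of the tensor field `g` in the preferred chart at `x₀`: the pull-back of `g`
by the inverse of the chart, evaluated at the point `e` of the model space on `v` and `w`. -/
def coordTensor (g : TensorField02 I M) (x₀ : M) (e v w : E) : ℝ :=
  g ((extChartAt I x₀).symm e)
    (mfderiv 𝓘(ℝ, E) I (extChartAt I x₀).symm e v)
    (mfderiv 𝓘(ℝ, E) I (extChartAt I x₀).symm e w)

/-- The Christoffel symbols of the first kind of `g` in the preferred chart at `x₀`:
`Γ(u, v; w) = (∂_u g(v, w) + ∂_v g(u, w) - ∂_w g(u, v)) / 2`, where `u`, `v`, `w` are extended as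
constant vector fields of the model space. It is the lowered form `g(∇_u v, w)` of the
Levi-Civita connection. -/
def christoffelFirst (g : TensorField02 I M) (x₀ : M) (e u v w : E) : ℝ :=
  (fderiv ℝ (fun e' ↦ coordTensor g x₀ e' v w) e u
    + fderiv ℝ (fun e' ↦ coordTensor g x₀ e' u w) e v
    - fderiv ℝ (fun e' ↦ coordTensor g x₀ e' u v) e w) / 2

/-- The curve `γ` is a smooth (affinely parametrized) geodesic on the set of parameters `s` of the
Riemannian or semi-Riemannian metric `g` on the manifold without boundary `M`: in the
chart at `γ t`, with `c` the coordinate expression of `γ`, the covector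
`g(∇_γ̇ γ̇, ·) = g(c'', ·) + Γ(c', c'; ·)` vanishes at `t`, for all `t ∈ s`.
As `g` is nondegenerate, this says `∇_γ̇ γ̇ = 0` (a tensorial condition, so it does not depend on
the chart). On `s = [0, 1]` the derivatives at the end points are one-sided. -/
def IsGeodesicOn (g : TensorField02 I M) (γ : ℝ → M) (s : Set ℝ) : Prop :=
  ContMDiffOn 𝓘(ℝ, ℝ) I ∞ γ s ∧
    ∀ t ∈ s, ∀ w : E,
      let c : ℝ → E := fun t' ↦ extChartAt I (γ t) (γ t')
      coordTensor g (γ t) (c t) (derivWithin (derivWithin c s) s t) w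
        + christoffelFirst g (γ t) (c t) (derivWithin c s t) (derivWithin c s t) w = 0

/-- The velocity at `t` of a curve defined on `s`. -/
def velocityWithin (I : ModelWithCorners ℝ E H) (γ : ℝ → M) (s : Set ℝ) (t : ℝ) :
    TangentSpace I (γ t) :=
  mfderivWithin 𝓘(ℝ, ℝ) I γ s t (1 : ℝ)

end Geodesic

/-- The tensor field underlying a smooth Riemannian metric. -/
def riemTensor {E H : Type*} [NormedAddCommGroup E] [NormedSpace ℝ E] [TopologicalSpace H]
    {I : ModelWithCorners ℝ E H} {M : Type*} [TopologicalSpace M] [ChartedSpace H M]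
    [IsManifold I ∞ M]
    (g : Bundle.ContMDiffRiemannianMetric I ∞ E (fun x : M ↦ TangentSpace I x)) :
    TensorField02 I M :=
  fun x ↦ LinearMap.mk₂ ℝ (fun v w ↦ g.inner x v w)
    (by simp) (by simp) (by simp) (by simp)

/-- The sum `π₁^* h₁ + f · π₂^* h₂` on the product `M₁ × M₂`, for a function `f` on `M₁`, where
`π₁` and `π₂` are the two projections. -/
def warpedTensor {E₁ H₁ E₂ H₂ : Type*}
    [NormedAddCommGroup E₁] [NormedSpace ℝ E₁] [TopologicalSpace H₁]
    [NormedAddCommGroup E₂] [NormedSpace ℝ E₂] [TopologicalSpace H₂]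
    {I₁ : ModelWithCorners ℝ E₁ H₁} {I₂ : ModelWithCorners ℝ E₂ H₂}
    {M₁ M₂ : Type*} [TopologicalSpace M₁] [ChartedSpace H₁ M₁]
    [TopologicalSpace M₂] [ChartedSpace H₂ M₂]
    (h₁ : TensorField02 I₁ M₁) (f : M₁ → ℝ) (h₂ : TensorField02 I₂ M₂) :
    TensorField02 (I₁.prod I₂) (M₁ × M₂) :=
  fun p ↦
    (h₁ p.1).compl₁₂ (mfderiv (I₁.prod I₂) I₁ Prod.fst p).toLinearMap
        (mfderiv (I₁.prod I₂) I₁ Prod.fst p).toLinearMap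
      + f p.1 • (h₂ p.2).compl₁₂ (mfderiv (I₁.prod I₂) I₂ Prod.snd p).toLinearMap
        (mfderiv (I₁.prod I₂) I₂ Prod.snd p).toLinearMap

open Classical in
/-- The lower bound `k₁` of the admissible parameters `r`: it is `- 1 / sup k` if `k` is bounded
from above, and `0` otherwise. -/
def lowerParam {X : Type*} (k : X → ℝ) : ℝ :=
  if BddAbove (range k) then -(⨆ x, k x)⁻¹ else 0

section RiemannianGeodesic

variable {E₁ E₂ : Type*}
  [NormedAddCommGroup E₁] [NormedSpace ℝ E₁] [NormedAddCommGroup E₂] [NormedSpace ℝ E₂]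
  {M₁ M₂ : Type*}
  [TopologicalSpace M₁] [ChartedSpace E₁ M₁] [IsManifold 𝓘(ℝ, E₁) ∞ M₁]
  [TopologicalSpace M₂] [ChartedSpace E₂ M₂] [IsManifold 𝓘(ℝ, E₂) ∞ M₂]
  (g₁ : Bundle.ContMDiffRiemannianMetric 𝓘(ℝ, E₁) ∞ E₁ (fun x : M₁ ↦ TangentSpace 𝓘(ℝ, E₁) x))
  (g₂ : Bundle.ContMDiffRiemannianMetric 𝓘(ℝ, E₂) ∞ E₂ (fun x : M₂ ↦ TangentSpace 𝓘(ℝ, E₂) x))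
  (k : M₁ → ℝ) (r : ℝ)

/-- The semi-Riemannian warped product metric `g = g₁ - k g₂` on `M₁ × M₂`. -/
def warpedMetric : TensorField02 (𝓘(ℝ, E₁).prod 𝓘(ℝ, E₂)) (M₁ × M₂) :=
  warpedTensor (riemTensor g₁) (fun x ↦ -k x) (riemTensor g₂)

/-- The conformal metric `G_r = (1/k + r) g₁` on `M₁`. -/
def conformalMetric : TensorField02 𝓘(ℝ, E₁) M₁ :=
  fun x ↦ (1 / k x + r) • riemTensor g₁ x

/-- The metric `G_r + g₂` on `M₁ × M₂`. -/
def productMetric : TensorField02 (𝓘(ℝ, E₁).prod 𝓘(ℝ, E₂)) (M₁ × M₂) :=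
  warpedTensor (conformalMetric g₁ k r) (fun _ ↦ 1) (riemTensor g₂)

/-- `φ` is a smooth diffeomorphism of `[0, 1]` fixing `0` and `1`, with derivative `φ'` on `[0, 1]`.
(When `φ'` has no zero the inverse is smooth as well.) -/
structure IsReparam (φ φ' : ℝ → ℝ) : Prop where
  map_zero : φ 0 = 0
  map_one : φ 1 = 1
  bijOn : BijOn φ (Icc 0 1) (Icc 0 1)
  contDiffOn : ContDiffOn ℝ ∞ φ (Icc 0 1)
  hasDeriv : ∀ t ∈ Icc (0 : ℝ) 1, HasDerivWithinAt φ (φ' t) (Icc 0 1) t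
  deriv_ne_zero : ∀ t ∈ Icc (0 : ℝ) 1, φ' t ≠ 0

/-- `(γ, τ) : [0, 1] → M₁ × M₂` is a Riemannian geodesic of `g = g₁ - k g₂` with parameter `r`: it
is a geodesic of `g`, and it is obtained from a geodesic `(μ, ν) : [0, 1] → M₁ × M₂` of `G_r + g₂`
as `γ = μ ∘ φ`, `τ = ν ∘ ψ`, where `φ` and `ψ` are the diffeomorphisms of `[0, 1]` fixing the
end points with `φ' = a (1 + r k) / k ∘ μ ∘ φ` and `ψ' = b / k ∘ γ` for
constants `a`, `b`, and the initial velocities of `μ`, `ν` satisfy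
`a² ((1 + r k(x₀)) / k(x₀)) g₁(μ̇(0), μ̇(0)) = b² g₂(ν̇(0), ν̇(0))`, with `x₀ = μ(0)`. -/
def IsRiemannianGeodesic (γ : ℝ → M₁) (τ : ℝ → M₂) : Prop :=
  IsGeodesicOn (warpedMetric g₁ g₂ k) (fun t ↦ (γ t, τ t)) (Icc 0 1) ∧
  ∃ (μ : ℝ → M₁) (ν : ℝ → M₂) (φ ψ : ℝ → ℝ) (a b : ℝ),
    IsGeodesicOn (productMetric g₁ g₂ k r) (fun t ↦ (μ t, ν t)) (Icc 0 1) ∧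
    IsReparam φ (fun t ↦ a * ((1 + r * k (μ (φ t))) / k (μ (φ t)))) ∧
    IsReparam ψ (fun t ↦ b / k (γ t)) ∧
    EqOn γ (μ ∘ φ) (Icc 0 1) ∧ EqOn τ (ν ∘ ψ) (Icc 0 1) ∧
    a ^ 2 * ((1 + r * k (μ 0)) / k (μ 0)) *
        g₁.inner (μ 0) (velocityWithin 𝓘(ℝ, E₁) μ (Icc 0 1) 0)
          (velocityWithin 𝓘(ℝ, E₁) μ (Icc 0 1) 0)
      = b ^ 2 * g₂.inner (ν 0) (velocityWithin 𝓘(ℝ, E₂) ν (Icc 0 1) 0)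
          (velocityWithin 𝓘(ℝ, E₂) ν (Icc 0 1) 0)

/-- The points `p` and `q` of `M₁ × M₂` are joined by a Riemannian geodesic of `g = g₁ - k g₂`
with parameter `r`. -/
def JoinedByRiemannianGeodesic (p q : M₁ × M₂) : Prop :=
  ∃ (γ : ℝ → M₁) (τ : ℝ → M₂), IsRiemannianGeodesic g₁ g₂ k r γ τ ∧
    (γ 0, τ 0) = p ∧ (γ 1, τ 1) = q

end RiemannianGeodesic

end

/-! Write `θ = 1/k + r`. The metric `G_r + g₂` is a direct product, so both components of `(μ, ν)`
are geodesics, and their squared speeds `A` (for `G_r = θ g₁`) and `B` (for `g₂`) are constant.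

The geodesic equation of `g₁ - k g₂` for `(γ, τ)` has two components: `g₁(∇_γ̇ γ̇, ·) = -g₂(τ̇, τ̇)
dk / 2`, and `k τ̇` is parallel along `τ`. If `γ = μ ∘ σ` with `σ' = p θ`, the conformal change from
`G_r` to `g₁` together with the change of parameter gives `g₁(∇_γ̇ γ̇, ·) = -(p² A / k²) dk / 2`. If
`τ = ν ∘ ρ` with `ρ' = m / k`, then `k τ̇` is parallel and `g₂(τ̇, τ̇) = m² B / k²`. Hence `p² A =
m² B` makes `(γ, τ)` a geodesic of `g`; this is `isGeodesicOn_warpedMetric_comp`.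

The two parameters satisfy `dρ/dσ = (m/p) / (1 + r k)`. With `F(α) = ∫₀^α du / (1 + r k(μ u))`,
reaching `μ α` and `ν β` at the same time therefore only requires `F(α)² A = β² B`; this is
`joinedByRiemannianGeodesic_of_sq_eq`. Given `α`, one solves for `β` directly. Given `β`, one needs
`F` to be onto, which holds when `k` is bounded above, since the integrand is then bounded away from
zero. -/

noncomputable section

open Filter Topology

/-! ### Derivatives of bilinear forms along curves -/

/-- The form is only assumed differentiable on each fixed pair of vectors, so the product rule comes
from a finite basis. Up to first order, `B s (v s) (w s)` splits into `B s (v t) (w t)` and two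
terms with a factor `v s - v t` or `w s - w t` that vanishes at `t`. -/
theorem hasDerivAt_bilinForm_apply {E : Type*} [NormedAddCommGroup E] [NormedSpace ℝ E]
    [FiniteDimensional ℝ E] {B : ℝ → LinearMap.BilinForm ℝ E} {v w : ℝ → E} {b' : ℝ} {v' w' : E}
    {t : ℝ} (hB : ∀ x y, DifferentiableAt ℝ (fun s ↦ B s x y) t)
    (hb : HasDerivAt (fun s ↦ B s (v t) (w t)) b' t) (hv : HasDerivAt v v' t)
    (hw : HasDerivAt w w' t) :
    HasDerivAt (fun s ↦ B s (v s) (w s)) (b' + B t v' (w t) + B t (v t) w') t := by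
  let bas := Module.finBasis ℝ E
  have coord : ∀ (u : ℝ → E) (u' : E), HasDerivAt u u' t → ∀ i,
      HasDerivAt (fun s ↦ bas.repr (u s) i) (bas.repr u' i) t := fun u u' hu i ↦
    (LinearMap.toContinuousLinearMap (bas.coord i)).hasFDerivAt.comp_hasDerivAt t hu
  have expand : ∀ (L : E →ₗ[ℝ] ℝ) (u : E), L u = ∑ i, bas.repr u i * L (bas i) := fun L u ↦ by
    conv_lhs => rw [← bas.sum_repr u, map_sum]
    simp only [map_smul, smul_eq_mul]
  have h1 : HasDerivAt (fun s ↦ B s (v t) (w s - w t)) (B t (v t) w') t := by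
    have : HasDerivAt (fun s ↦ ∑ i, bas.repr (w s - w t) i * B s (v t) (bas i))
        (∑ i, bas.repr w' i * B t (v t) (bas i)) t := by
      refine HasDerivAt.fun_sum fun i _ ↦ ?_
      have := (coord _ _ (hw.sub_const (w t)) i).fun_mul (hB (v t) (bas i)).hasDerivAt
      simpa using this
    rw [expand (B t (v t)) w']
    exact this.congr_of_eventuallyEq (Eventually.of_forall fun s ↦ expand (B s (v t)) _)
  have hdw : ∀ i, DifferentiableAt ℝ (fun s ↦ B s (bas i) (w s)) t := fun i ↦ by
    have : (fun s ↦ B s (bas i) (w s)) =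
        fun s ↦ ∑ j, bas.repr (w s) j * B s (bas i) (bas j) := by
      funext s
      exact expand _ _
    rw [this]
    exact DifferentiableAt.fun_sum fun j _ ↦
      (coord _ _ hw j).differentiableAt.mul (hB (bas i) (bas j))
  have h2 : HasDerivAt (fun s ↦ B s (v s - v t) (w s)) (B t v' (w t)) t := by
    have : HasDerivAt (fun s ↦ ∑ i, bas.repr (v s - v t) i * B s (bas i) (w s))
        (∑ i, bas.repr v' i * B t (bas i) (w t)) t := by
      refine HasDerivAt.fun_sum fun i _ ↦ ?_
      have := (coord _ _ (hv.sub_const (v t)) i).fun_mul (hdw i).hasDerivAt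
      simpa using this
    have e2 : ∀ s u, B s u (w s) = ∑ i, bas.repr u i * B s (bas i) (w s) := fun s u ↦
      expand ((B s).flip (w s)) u
    rw [e2 t v']
    exact this.congr_of_eventuallyEq (Eventually.of_forall fun s ↦ e2 s _)
  refine ((hb.add h2).add h1).congr_of_eventuallyEq (Eventually.of_forall fun s ↦ ?_)
  simp [map_sub, LinearMap.sub_apply]
  ring

/-! ### Components of tensor fields in charts -/

section Coord

variable {E H : Type*} [NormedAddCommGroup E] [NormedSpace ℝ E] [TopologicalSpace H]
  {I : ModelWithCorners ℝ E H} {M : Type*} [TopologicalSpace M] [ChartedSpace H M]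

/-- The components of a tensor field in a chart, as a bilinear form on the model space. -/
def coordForm (h : TensorField02 I M) (x₀ : M) (e : E) : LinearMap.BilinForm ℝ E :=
  (h ((extChartAt I x₀).symm e)).compl₁₂
    (mfderiv 𝓘(ℝ, E) I (extChartAt I x₀).symm e).toLinearMap
    (mfderiv 𝓘(ℝ, E) I (extChartAt I x₀).symm e).toLinearMap

theorem coordTensor_eq_coordForm (h : TensorField02 I M) (x₀ : M) (e v w : E) :
    coordTensor h x₀ e v w = coordForm h x₀ e v w := rfl

theorem coordTensor_add_left (h : TensorField02 I M) (x₀ : M) (e v v' w : E) :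
    coordTensor h x₀ e (v + v') w = coordTensor h x₀ e v w + coordTensor h x₀ e v' w := by
  simp [coordTensor_eq_coordForm]

theorem coordTensor_smul_left (h : TensorField02 I M) (x₀ : M) (e v w : E) (a : ℝ) :
    coordTensor h x₀ e (a • v) w = a * coordTensor h x₀ e v w := by
  simp [coordTensor_eq_coordForm]

theorem coordTensor_smul_right (h : TensorField02 I M) (x₀ : M) (e v w : E) (a : ℝ) :
    coordTensor h x₀ e v (a • w) = a * coordTensor h x₀ e v w := by
  simp [coordTensor_eq_coordForm]

theorem coordTensor_zero_right (h : TensorField02 I M) (x₀ : M) (e v : E) :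
    coordTensor h x₀ e v 0 = 0 := by
  simp [coordTensor_eq_coordForm]

/-- The components of the tensor field in every preferred chart are differentiable at the centre
of the chart. -/
def ChartDifferentiable (h : TensorField02 I M) : Prop :=
  ∀ x₀ v w, DifferentiableAt ℝ (fun e ↦ coordTensor h x₀ e v w) (extChartAt I x₀ x₀)

/-- The covector `g(∇_ċ ċ, ·)` of a curve `c` in the model space, for the components of `g` in the
preferred chart at `x₀`. -/
def accelCovector (g : TensorField02 I M) (x₀ : M) (c : ℝ → E) (t : ℝ) (w : E) : ℝ :=
  coordTensor g x₀ (c t) (deriv (deriv c) t) w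
    + christoffelFirst g x₀ (c t) (deriv c t) (deriv c t) w

theorem christoffelFirst_diag (g : TensorField02 I M) (x₀ : M) (e u w : E) :
    christoffelFirst g x₀ e u u w = fderiv ℝ (fun e' ↦ coordTensor g x₀ e' u w) e u
      - fderiv ℝ (fun e' ↦ coordTensor g x₀ e' u u) e w / 2 := by
  unfold christoffelFirst
  ring

theorem christoffelFirst_smul (g : TensorField02 I M) (x₀ : M) (e u w : E) (a : ℝ) :
    christoffelFirst g x₀ e (a • u) (a • u) w = a ^ 2 * christoffelFirst g x₀ e u u w := by
  -- A constant scalar passes through `fderiv` whether or not `f` is differentiable, so no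
  -- smoothness of the components is needed.
  have key : ∀ (f : E → ℝ) (b : ℝ) (v : E),
      fderiv ℝ (fun e' ↦ b * f e') e v = b * fderiv ℝ f e v := fun f b v ↦ by
    change fderiv ℝ (b • f) e v = _
    rw [fderiv_const_smul_field]
    rfl
  simp only [christoffelFirst_diag, coordTensor_smul_left, coordTensor_smul_right, map_smul,
    smul_eq_mul, key]
  ring

theorem derivWithin_derivWithin_of_contDiffAt {c : ℝ → E} {s : Set ℝ} {t : ℝ}
    (hs : UniqueDiffOn ℝ s) (ht : t ∈ s) (hc : ContDiffAt ℝ ∞ c t) :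
    derivWithin c s t = deriv c t ∧ derivWithin (derivWithin c s) s t = deriv (deriv c) t := by
  have hev : ∀ᶠ t' in 𝓝 t, DifferentiableAt ℝ c t' :=
    ((hc.of_le (by simp : (1 : WithTop ℕ∞) ≤ ∞)).eventually (by simp)).mono
      fun t' h ↦ h.differentiableAt (by simp)
  have h2 : DifferentiableAt ℝ (deriv c) t :=
    (hc.derivWithin (m := ∞) le_rfl).differentiableAt (by simp)
  refine ⟨hev.self_of_nhds.derivWithin (hs t ht), ?_⟩
  rw [← h2.derivWithin (hs t ht)]
  refine Filter.EventuallyEq.derivWithin_eq_of_mem ?_ ht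
  filter_upwards [hev.filter_mono nhdsWithin_le_nhds, self_mem_nhdsWithin] with t' h h'
  exact h.derivWithin (hs t' h')

theorem contDiffAt_chart_comp [IsManifold I ∞ M] {γ : ℝ → M} (hγ : ContMDiff 𝓘(ℝ, ℝ) I ∞ γ)
    {x₀ : M} {t : ℝ} (ht : γ t ∈ (chartAt H x₀).source) :
    ContDiffAt ℝ ∞ (fun s ↦ extChartAt I x₀ (γ s)) t :=
  ((contMDiffAt_extChartAt' ht).comp t (hγ t)).contDiffAt

/-- For a curve smooth on all of `ℝ` the one-sided derivatives in the definition agree with the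
ordinary ones, also at the end points of `[0, 1]`. Everything below can use `deriv`. -/
theorem isGeodesicOn_iff_of_contMDiff [IsManifold I ∞ M] (g : TensorField02 I M) {γ : ℝ → M}
    (hγ : ContMDiff 𝓘(ℝ, ℝ) I ∞ γ) {s : Set ℝ} (hs : UniqueDiffOn ℝ s) :
    IsGeodesicOn g γ s ↔
      ∀ t ∈ s, ∀ w, accelCovector g (γ t) (fun t' ↦ extChartAt I (γ t) (γ t')) t w = 0 := by
  unfold IsGeodesicOn
  rw [and_iff_right hγ.contMDiffOn]
  refine forall₂_congr fun t ht ↦ forall_congr' fun w ↦ ?_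
  obtain ⟨h1, h2⟩ := derivWithin_derivWithin_of_contDiffAt hs ht
    (contDiffAt_chart_comp (x₀ := γ t) hγ (mem_chart_source H (γ t)))
  simp only [accelCovector, h1, h2]

end Coord

/-! ### Smoothness of metric components in charts. -/

section Boundaryless

variable {E : Type*} [NormedAddCommGroup E] [NormedSpace ℝ E]
  {M : Type*} [TopologicalSpace M] [ChartedSpace E M] [IsManifold 𝓘(ℝ, E) ∞ M]

theorem mdifferentiableAt_extChartAt_symm {x₀ : M} {e : E}
    (he : e ∈ (extChartAt 𝓘(ℝ, E) x₀).target) :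
    MDifferentiableAt 𝓘(ℝ, E) 𝓘(ℝ, E) (extChartAt 𝓘(ℝ, E) x₀).symm e :=
  ((contMDiffOn_extChartAt_symm (n := ∞) x₀).contMDiffAt
    ((isOpen_extChartAt_target x₀).mem_nhds he)).mdifferentiableAt (by simp)

/-- Coordinate vector fields are smooth because the trivialization of the tangent bundle at `x₀` is
the derivative of the chart, and so reads them as the constant `v`. -/
theorem contMDiffAt_chart_frame (x₀ : M) (v : E) :
    ContMDiffAt 𝓘(ℝ, E) (𝓘(ℝ, E).prod 𝓘(ℝ, E)) ∞
      (fun e : E ↦ (Bundle.TotalSpace.mk' E ((extChartAt 𝓘(ℝ, E) x₀).symm e)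
        (mfderiv 𝓘(ℝ, E) 𝓘(ℝ, E) (extChartAt 𝓘(ℝ, E) x₀).symm e v) :
        Bundle.TotalSpace E (fun x : M ↦ TangentSpace 𝓘(ℝ, E) x)))
      (extChartAt 𝓘(ℝ, E) x₀ x₀) := by
  have hmem := (isOpen_extChartAt_target (I := 𝓘(ℝ, E)) x₀).mem_nhds
    (mem_extChartAt_target (I := 𝓘(ℝ, E)) x₀)
  rw [Bundle.contMDiffAt_totalSpace]
  refine ⟨(contMDiffOn_extChartAt_symm (n := ∞) x₀).contMDiffAt hmem, ?_⟩
  refine (contMDiffAt_const (c := v)).congr_of_eventuallyEq ?_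
  filter_upwards [hmem] with e he
  have h0 : (extChartAt 𝓘(ℝ, E) x₀).symm (extChartAt 𝓘(ℝ, E) x₀ x₀) = x₀ :=
    extChartAt_to_inv x₀
  have hsrc : (extChartAt 𝓘(ℝ, E) x₀).symm e ∈ (chartAt E x₀).source := by
    rw [← extChartAt_source 𝓘(ℝ, E)]
    exact (extChartAt 𝓘(ℝ, E) x₀).map_target he
  have h1 := TangentBundle.continuousLinearMapAt_trivializationAt (I := 𝓘(ℝ, E)) hsrc
  have h2 := mfderiv_extChartAt_comp_mfderivWithin_extChartAt_symm (I := 𝓘(ℝ, E)) he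
  have h3 : (trivializationAt E (TangentSpace 𝓘(ℝ, E)) x₀).continuousLinearMapAt ℝ
      ((extChartAt 𝓘(ℝ, E) x₀).symm e)
      (mfderiv 𝓘(ℝ, E) 𝓘(ℝ, E) (extChartAt 𝓘(ℝ, E) x₀).symm e v) = v := by
    rw [h1]
    have := congrArg (fun L ↦ L v) h2
    simp only [modelWithCornersSelf_coe, range_id, mfderivWithin_univ] at this
    exact this
  rw [Bundle.Trivialization.continuousLinearMapAt_apply,
    Bundle.Trivialization.linearMapAt_apply, if_pos] at h3
  · simpa only [Bundle.TotalSpace.mk', h0] using h3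
  · simpa using hsrc

theorem chartDifferentiable_riemTensor
    (g : Bundle.ContMDiffRiemannianMetric 𝓘(ℝ, E) ∞ E (fun x : M ↦ TangentSpace 𝓘(ℝ, E) x)) :
    ChartDifferentiable (riemTensor g) := by
  intro x₀ v w
  have hmem := (isOpen_extChartAt_target (I := 𝓘(ℝ, E)) x₀).mem_nhds
    (mem_extChartAt_target (I := 𝓘(ℝ, E)) x₀)
  have hb := (contMDiffOn_extChartAt_symm (I := 𝓘(ℝ, E)) (n := ∞) x₀).contMDiffAt hmem
  have : ContMDiffAt 𝓘(ℝ, E) (𝓘(ℝ, E).prod 𝓘(ℝ, ℝ)) ∞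
      (fun e : E ↦ Bundle.TotalSpace.mk' ℝ (E := Bundle.Trivial M ℝ)
        ((extChartAt 𝓘(ℝ, E) x₀).symm e)
        (g.inner ((extChartAt 𝓘(ℝ, E) x₀).symm e)
          (mfderiv 𝓘(ℝ, E) 𝓘(ℝ, E) (extChartAt 𝓘(ℝ, E) x₀).symm e v)
          (mfderiv 𝓘(ℝ, E) 𝓘(ℝ, E) (extChartAt 𝓘(ℝ, E) x₀).symm e w)))
      (extChartAt 𝓘(ℝ, E) x₀ x₀) := by
    apply ContMDiffAt.clm_bundle_apply₂ (F₁ := E) (F₂ := E)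
    · exact g.contMDiff.contMDiffAt.comp _ hb
    · exact contMDiffAt_chart_frame x₀ v
    · exact contMDiffAt_chart_frame x₀ w
  rw [Bundle.contMDiffAt_totalSpace] at this
  exact this.2.contDiffAt.differentiableAt (by simp)

theorem contDiffAt_comp_chart_symm {f : M → ℝ} (hf : ContMDiff 𝓘(ℝ, E) 𝓘(ℝ, ℝ) ∞ f) (x₀ : M) :
    ContDiffAt ℝ ∞ (fun e ↦ f ((extChartAt 𝓘(ℝ, E) x₀).symm e)) (extChartAt 𝓘(ℝ, E) x₀ x₀) :=
  (hf.contMDiffAt.comp _ ((contMDiffOn_extChartAt_symm (I := 𝓘(ℝ, E)) (n := ∞) x₀).contMDiffAt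
    ((isOpen_extChartAt_target (I := 𝓘(ℝ, E)) x₀).mem_nhds
      (mem_extChartAt_target (I := 𝓘(ℝ, E)) x₀)))).contDiffAt

/-! ### Velocity and energy -/

/-- The squared length of the velocity of the curve `γ` with respect to `h`. -/
def speedSq (h : TensorField02 𝓘(ℝ, E) M) (γ : ℝ → M) (t : ℝ) : ℝ :=
  h (γ t) (mfderiv 𝓘(ℝ, ℝ) 𝓘(ℝ, E) γ t (1 : ℝ)) (mfderiv 𝓘(ℝ, ℝ) 𝓘(ℝ, E) γ t (1 : ℝ))

theorem mfderiv_chart_symm_deriv {γ : ℝ → M} (hγ : ContMDiff 𝓘(ℝ, ℝ) 𝓘(ℝ, E) ∞ γ) {x₀ : M} {t : ℝ}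
    (ht : γ t ∈ (chartAt E x₀).source) :
    (mfderiv 𝓘(ℝ, E) 𝓘(ℝ, E) (extChartAt 𝓘(ℝ, E) x₀).symm (extChartAt 𝓘(ℝ, E) x₀ (γ t))
      (deriv (fun s ↦ extChartAt 𝓘(ℝ, E) x₀ (γ s)) t) : E)
      = (mfderiv 𝓘(ℝ, ℝ) 𝓘(ℝ, E) γ t (1 : ℝ) : E) := by
  have ht' : γ t ∈ (extChartAt 𝓘(ℝ, E) x₀).source := by rwa [extChartAt_source]
  have hev : γ =ᶠ[𝓝 t] (extChartAt 𝓘(ℝ, E) x₀).symm ∘ (fun s ↦ extChartAt 𝓘(ℝ, E) x₀ (γ s)) := by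
    filter_upwards [hγ.continuous.continuousAt.preimage_mem_nhds
      ((isOpen_extChartAt_source (I := 𝓘(ℝ, E)) x₀).mem_nhds ht')] with s hs
    exact ((extChartAt 𝓘(ℝ, E) x₀).left_inv hs).symm
  have hc := (contDiffAt_chart_comp hγ ht).differentiableAt (by simp)
  rw [hev.mfderiv_eq, mfderiv_comp t
    (mdifferentiableAt_extChartAt_symm ((extChartAt 𝓘(ℝ, E) x₀).map_source ht'))
    hc.mdifferentiableAt, mfderiv_eq_fderiv]
  rfl

theorem speedSq_eq_coordTensor (h : TensorField02 𝓘(ℝ, E) M) {γ : ℝ → M}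
    (hγ : ContMDiff 𝓘(ℝ, ℝ) 𝓘(ℝ, E) ∞ γ) {x₀ : M} {t : ℝ} (ht : γ t ∈ (chartAt E x₀).source) :
    speedSq h γ t = coordTensor h x₀ (extChartAt 𝓘(ℝ, E) x₀ (γ t))
      (deriv (fun s ↦ extChartAt 𝓘(ℝ, E) x₀ (γ s)) t)
      (deriv (fun s ↦ extChartAt 𝓘(ℝ, E) x₀ (γ s)) t) := by
  have hbase : (extChartAt 𝓘(ℝ, E) x₀).symm (extChartAt 𝓘(ℝ, E) x₀ (γ t)) = γ t :=
    (extChartAt 𝓘(ℝ, E) x₀).left_inv (by rwa [extChartAt_source])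
  have hvel := mfderiv_chart_symm_deriv hγ ht
  -- The two base points are equal but not definitionally so. Treating all tangent vectors as
  -- elements of `E` allows the substitution.
  have key : ∀ (y : M) (u u' : E), y = γ t → u = u' →
      h (γ t) u' u' = h y u u := by
    rintro y u u' rfl rfl
    rfl
  exact key _ _ _ hbase hvel

/-- This is `d/dt h(γ̇, γ̇) = 2 h(∇_γ̇ γ̇, γ̇)`. On the diagonal `Γ(u, u; u) = ∂_u h(u, u) / 2`,
which accounts for the derivative of the components along the curve. -/
theorem hasDerivAt_speedSq [FiniteDimensional ℝ E] {h : TensorField02 𝓘(ℝ, E) M}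
    (hsymm : ∀ x v w, h x v w = h x w v) (hdiff : ChartDifferentiable h)
    {γ : ℝ → M} (hγ : ContMDiff 𝓘(ℝ, ℝ) 𝓘(ℝ, E) ∞ γ) (t : ℝ) :
    HasDerivAt (speedSq h γ)
      (2 * accelCovector h (γ t) (fun s ↦ extChartAt 𝓘(ℝ, E) (γ t) (γ s)) t
        (deriv (fun s ↦ extChartAt 𝓘(ℝ, E) (γ t) (γ s)) t)) t := by
  set c : ℝ → E := fun s ↦ extChartAt 𝓘(ℝ, E) (γ t) (γ s) with hc
  have hsm : ContDiffAt ℝ ∞ c t := contDiffAt_chart_comp hγ (mem_chart_source E (γ t))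
  have hc1 : HasDerivAt c (deriv c t) t := (hsm.differentiableAt (by simp)).hasDerivAt
  have hc2 : HasDerivAt (deriv c) (deriv (deriv c) t) t :=
    ((hsm.derivWithin (m := ∞) le_rfl).differentiableAt (by simp)).hasDerivAt
  have hev : speedSq h γ =ᶠ[𝓝 t] fun s ↦ coordForm h (γ t) (c s) (deriv c s) (deriv c s) := by
    filter_upwards [hγ.continuous.continuousAt.preimage_mem_nhds
      ((chartAt E (γ t)).open_source.mem_nhds (mem_chart_source E (γ t)))] with s hs
    exact speedSq_eq_coordTensor h hγ hs
  have hcomp : ∀ x y, HasDerivAt (fun s ↦ coordForm h (γ t) (c s) x y)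
      (fderiv ℝ (fun e ↦ coordTensor h (γ t) e x y) (c t) (deriv c t)) t := fun x y ↦ by
    have := (hdiff (γ t) x y).hasFDerivAt
    exact this.comp_hasDerivAt (f := c) t hc1
  refine ((hasDerivAt_bilinForm_apply (fun x y ↦ (hcomp x y).differentiableAt)
    (hcomp _ _) hc2 hc2).congr_of_eventuallyEq hev).congr_deriv ?_
  have hsw : coordForm h (γ t) (c t) (deriv c t) (deriv (deriv c) t)
      = coordForm h (γ t) (c t) (deriv (deriv c) t) (deriv c t) := hsymm _ _ _
  rw [hsw, accelCovector, christoffelFirst_diag, coordTensor_eq_coordForm]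
  ring

/-- A curve with zero velocity is constant. -/
theorem eq_of_mfderiv_eq_zero {γ : ℝ → M} (hγ : ContMDiff 𝓘(ℝ, ℝ) 𝓘(ℝ, E) ∞ γ)
    (h0 : ∀ t, mfderiv 𝓘(ℝ, ℝ) 𝓘(ℝ, E) γ t (1 : ℝ) = 0) (s t : ℝ) : γ s = γ t := by
  have hloc : IsLocallyConstant γ := by
    rw [IsLocallyConstant.iff_eventually_eq]
    intro t
    -- Near `t` the curve stays in one chart. Its coordinate expression has zero derivative on a
    -- ball, and the chart is injective.
    have hU := hγ.continuous.continuousAt.preimage_mem_nhds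
      ((chartAt E (γ t)).open_source.mem_nhds (mem_chart_source E (γ t)))
    obtain ⟨ε, hε, hball⟩ := Metric.mem_nhds_iff.1 hU
    have hderiv : ∀ s ∈ Metric.ball t ε,
        HasDerivAt (fun s ↦ extChartAt 𝓘(ℝ, E) (γ t) (γ s)) 0 s := fun s hs ↦ by
      have h1 : MDifferentiableAt 𝓘(ℝ, E) 𝓘(ℝ, E) (extChartAt 𝓘(ℝ, E) (γ t)) (γ s) :=
        mdifferentiableAt_extChartAt (hball hs)
      have h2 := mfderiv_comp s h1 (hγ.mdifferentiable (by simp) s)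
      have h3 := (contDiffAt_chart_comp hγ (hball hs)).differentiableAt (by simp) |>.hasDerivAt
      convert h3 using 1
      have h4 := congrArg (fun L ↦ L (1 : ℝ)) h2
      rw [mfderiv_eq_fderiv] at h4
      refine Eq.symm (h4.trans ?_)
      exact (congrArg (mfderiv 𝓘(ℝ, E) 𝓘(ℝ, E) (extChartAt 𝓘(ℝ, E) (γ t)) (γ s)) (h0 s)).trans
        (map_zero _)
    filter_upwards [Metric.ball_mem_nhds t hε] with s hs
    have heq := Metric.isOpen_ball.is_const_of_deriv_eq_zero
      (convex_ball t ε).isPreconnected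
      (fun s hs ↦ (hderiv s hs).differentiableAt.differentiableWithinAt)
      (fun s hs ↦ (hderiv s hs).deriv) hs (Metric.mem_ball_self hε)
    refine (extChartAt 𝓘(ℝ, E) (γ t)).injOn ?_ (mem_extChartAt_source (γ t)) heq
    rw [extChartAt_source]
    exact hball hs
  exact hloc.apply_eq_of_isPreconnected isPreconnected_univ (mem_univ _) (mem_univ _)

/-! ### Conformal change and reparametrization -/

/-- The product rule for the components `f h`: the two extra terms are the derivatives falling on
`f` in `∂_u h(u, w) - ∂_w h(u, u) / 2`. -/
theorem accelCovector_conformal {h : TensorField02 𝓘(ℝ, E) M} (hdiff : ChartDifferentiable h)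
    {f : M → ℝ} (hf : ContMDiff 𝓘(ℝ, E) 𝓘(ℝ, ℝ) ∞ f) {x₀ : M} {c : ℝ → E} {t : ℝ}
    (hct : c t = extChartAt 𝓘(ℝ, E) x₀ x₀) (w : E) :
    accelCovector (fun x ↦ f x • h x) x₀ c t w = f x₀ * accelCovector h x₀ c t w
      + fderiv ℝ (fun e ↦ f ((extChartAt 𝓘(ℝ, E) x₀).symm e)) (c t) (deriv c t)
        * coordTensor h x₀ (c t) (deriv c t) w
      - fderiv ℝ (fun e ↦ f ((extChartAt 𝓘(ℝ, E) x₀).symm e)) (c t) w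
        * coordTensor h x₀ (c t) (deriv c t) (deriv c t) / 2 := by
  have hF := (contDiffAt_comp_chart_symm hf x₀).differentiableAt (by simp)
  have hcoord : ∀ e v w, coordTensor (fun x ↦ f x • h x) x₀ e v w
      = f ((extChartAt 𝓘(ℝ, E) x₀).symm e) * coordTensor h x₀ e v w := fun _ _ _ ↦ rfl
  have hfd : ∀ u v w, fderiv ℝ (fun e ↦ coordTensor (fun x ↦ f x • h x) x₀ e v w) (c t) u
      = f x₀ * fderiv ℝ (fun e ↦ coordTensor h x₀ e v w) (c t) u
        + fderiv ℝ (fun e ↦ f ((extChartAt 𝓘(ℝ, E) x₀).symm e)) (c t) u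
          * coordTensor h x₀ (c t) v w := fun u v w ↦ by
    simp only [hcoord]
    rw [hct, fderiv_fun_mul hF (hdiff x₀ v w), extChartAt_to_inv]
    simp only [add_apply, smul_apply, smul_eq_mul]
    ring
  rw [accelCovector, accelCovector, christoffelFirst_diag, christoffelFirst_diag, hfd, hfd, hcoord]
  have : f ((extChartAt 𝓘(ℝ, E) x₀).symm (c t)) = f x₀ := by rw [hct, extChartAt_to_inv]
  rw [this]
  ring

theorem chartDifferentiable_conformal {h : TensorField02 𝓘(ℝ, E) M} (hdiff : ChartDifferentiable h)
    {f : M → ℝ} (hf : ContMDiff 𝓘(ℝ, E) 𝓘(ℝ, ℝ) ∞ f) :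
    ChartDifferentiable (fun x ↦ f x • h x) := fun x₀ v w ↦
  ((contDiffAt_comp_chart_symm hf x₀).differentiableAt (by simp)).fun_mul (hdiff x₀ v w)

end Boundaryless

section Reparam

variable {E H : Type*} [NormedAddCommGroup E] [NormedSpace ℝ E] [TopologicalSpace H]
  {I : ModelWithCorners ℝ E H} {M : Type*} [TopologicalSpace M] [ChartedSpace H M]

theorem deriv_comp_reparam {c : ℝ → E} {σ : ℝ → ℝ} (hσ : ContDiff ℝ ∞ σ) {t : ℝ}
    (hc : ContDiffAt ℝ ∞ c (σ t)) :
    deriv (fun s ↦ c (σ s)) t = deriv σ t • deriv c (σ t) ∧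
    deriv (deriv fun s ↦ c (σ s)) t
      = deriv σ t ^ 2 • deriv (deriv c) (σ t) + deriv (deriv σ) t • deriv c (σ t) := by
  have hσ1 : ∀ s, HasDerivAt σ (deriv σ s) s := fun s ↦
    (hσ.differentiable (by simp) s).hasDerivAt
  have hσ2 : HasDerivAt (deriv σ) (deriv (deriv σ) t) t :=
    (((contDiff_infty_iff_deriv.1 hσ).2.differentiable (by simp)) t).hasDerivAt
  have hev : ∀ᶠ s in 𝓝 t, DifferentiableAt ℝ c (σ s) :=
    hσ.continuous.continuousAt.eventually
      (((hc.of_le (by simp : (1 : WithTop ℕ∞) ≤ ∞)).eventually (by simp)).mono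
        fun t' h ↦ h.differentiableAt (by simp))
  have h1 : ∀ᶠ s in 𝓝 t, deriv (fun s ↦ c (σ s)) s = deriv σ s • deriv c (σ s) :=
    hev.mono fun s hs ↦ (hs.hasDerivAt.scomp s (hσ1 s)).deriv
  have h2 : HasDerivAt (deriv c) (deriv (deriv c) (σ t)) (σ t) :=
    ((hc.derivWithin (m := ∞) le_rfl).differentiableAt (by simp)).hasDerivAt
  refine ⟨h1.self_of_nhds, ?_⟩
  rw [Filter.EventuallyEq.deriv_eq h1]
  refine ((hσ2.fun_smul (h2.scomp t (hσ1 t))).congr_deriv ?_).deriv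
  rw [smul_smul, sq]
  rfl

/-- The quadratic part of the acceleration scales by `σ'²`, and `σ''` contributes a tangential term.
-/
theorem accelCovector_comp (h : TensorField02 I M) (x₀ : M) {c : ℝ → E} {σ : ℝ → ℝ}
    (hσ : ContDiff ℝ ∞ σ) {t : ℝ} (hc : ContDiffAt ℝ ∞ c (σ t)) (w : E) :
    accelCovector h x₀ (fun s ↦ c (σ s)) t w = deriv σ t ^ 2 * accelCovector h x₀ c (σ t) w
      + deriv (deriv σ) t * coordTensor h x₀ (c (σ t)) (deriv c (σ t)) w := by
  obtain ⟨h1, h2⟩ := deriv_comp_reparam hσ hc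
  rw [accelCovector, accelCovector, h1, h2, christoffelFirst_smul, coordTensor_add_left,
    coordTensor_smul_left, coordTensor_smul_left]
  ring

end Reparam

/-! ### Warped products -/

section Product

variable {E₁ E₂ : Type*} [NormedAddCommGroup E₁] [NormedSpace ℝ E₁]
  [NormedAddCommGroup E₂] [NormedSpace ℝ E₂]
  {M₁ M₂ : Type*}
  [TopologicalSpace M₁] [ChartedSpace E₁ M₁] [IsManifold 𝓘(ℝ, E₁) ∞ M₁]
  [TopologicalSpace M₂] [ChartedSpace E₂ M₂] [IsManifold 𝓘(ℝ, E₂) ∞ M₂]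

/-- The chart of the product is the product of the charts, so the projection commutes with inverse
charts; differentiate both composites. -/
theorem mfderiv_fst_chart_symm {x : M₁} {y : M₂} {e : E₁ × E₂}
    (h₁ : e.1 ∈ (extChartAt 𝓘(ℝ, E₁) x).target) (h₂ : e.2 ∈ (extChartAt 𝓘(ℝ, E₂) y).target)
    (v : E₁ × E₂) :
    (mfderiv (𝓘(ℝ, E₁).prod 𝓘(ℝ, E₂)) 𝓘(ℝ, E₁) Prod.fst
      ((extChartAt (𝓘(ℝ, E₁).prod 𝓘(ℝ, E₂)) (x, y)).symm e)
      (mfderiv 𝓘(ℝ, E₁ × E₂) (𝓘(ℝ, E₁).prod 𝓘(ℝ, E₂))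
        (extChartAt (𝓘(ℝ, E₁).prod 𝓘(ℝ, E₂)) (x, y)).symm e v) : E₁)
      = mfderiv 𝓘(ℝ, E₁) 𝓘(ℝ, E₁) (extChartAt 𝓘(ℝ, E₁) x).symm e.1 v.1 := by
  have hs : MDifferentiableAt 𝓘(ℝ, E₁ × E₂) (𝓘(ℝ, E₁).prod 𝓘(ℝ, E₂))
      (extChartAt (𝓘(ℝ, E₁).prod 𝓘(ℝ, E₂)) (x, y)).symm e :=
    ((contMDiffOn_extChartAt_symm (I := 𝓘(ℝ, E₁).prod 𝓘(ℝ, E₂)) (n := ∞) (x, y)).contMDiffAt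
      ((isOpen_extChartAt_target (x, y)).mem_nhds (by
        rw [extChartAt_prod]
        exact ⟨h₁, h₂⟩))).mdifferentiableAt (by simp)
  have hA := mfderiv_comp (I' := 𝓘(ℝ, E₁).prod 𝓘(ℝ, E₂)) (I'' := 𝓘(ℝ, E₁)) e
    (g := Prod.fst) mdifferentiableAt_fst hs
  have hB := mfderiv_comp (I := 𝓘(ℝ, E₁ × E₂)) (I' := 𝓘(ℝ, E₁)) (I'' := 𝓘(ℝ, E₁))
    (f := (Prod.fst : E₁ × E₂ → E₁)) e (mdifferentiableAt_extChartAt_symm h₁)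
    differentiableAt_fst.mdifferentiableAt
  have hfun : Prod.fst ∘ (extChartAt (𝓘(ℝ, E₁).prod 𝓘(ℝ, E₂)) (x, y)).symm
      = (extChartAt 𝓘(ℝ, E₁) x).symm ∘ (Prod.fst : E₁ × E₂ → E₁) := by
    rw [extChartAt_prod]
    rfl
  rw [hfun, hB, mfderiv_eq_fderiv, fderiv_fst] at hA
  exact (congrArg (fun L ↦ L v) hA).symm

theorem mfderiv_snd_chart_symm {x : M₁} {y : M₂} {e : E₁ × E₂}
    (h₁ : e.1 ∈ (extChartAt 𝓘(ℝ, E₁) x).target) (h₂ : e.2 ∈ (extChartAt 𝓘(ℝ, E₂) y).target)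
    (v : E₁ × E₂) :
    (mfderiv (𝓘(ℝ, E₁).prod 𝓘(ℝ, E₂)) 𝓘(ℝ, E₂) Prod.snd
      ((extChartAt (𝓘(ℝ, E₁).prod 𝓘(ℝ, E₂)) (x, y)).symm e)
      (mfderiv 𝓘(ℝ, E₁ × E₂) (𝓘(ℝ, E₁).prod 𝓘(ℝ, E₂))
        (extChartAt (𝓘(ℝ, E₁).prod 𝓘(ℝ, E₂)) (x, y)).symm e v) : E₂)
      = mfderiv 𝓘(ℝ, E₂) 𝓘(ℝ, E₂) (extChartAt 𝓘(ℝ, E₂) y).symm e.2 v.2 := by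
  have hs : MDifferentiableAt 𝓘(ℝ, E₁ × E₂) (𝓘(ℝ, E₁).prod 𝓘(ℝ, E₂))
      (extChartAt (𝓘(ℝ, E₁).prod 𝓘(ℝ, E₂)) (x, y)).symm e :=
    ((contMDiffOn_extChartAt_symm (I := 𝓘(ℝ, E₁).prod 𝓘(ℝ, E₂)) (n := ∞) (x, y)).contMDiffAt
      ((isOpen_extChartAt_target (x, y)).mem_nhds (by
        rw [extChartAt_prod]
        exact ⟨h₁, h₂⟩))).mdifferentiableAt (by simp)
  have hA := mfderiv_comp (I' := 𝓘(ℝ, E₁).prod 𝓘(ℝ, E₂)) (I'' := 𝓘(ℝ, E₂)) e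
    (g := Prod.snd) mdifferentiableAt_snd hs
  have hB := mfderiv_comp (I := 𝓘(ℝ, E₁ × E₂)) (I' := 𝓘(ℝ, E₂)) (I'' := 𝓘(ℝ, E₂))
    (f := (Prod.snd : E₁ × E₂ → E₂)) e (mdifferentiableAt_extChartAt_symm h₂)
    differentiableAt_snd.mdifferentiableAt
  have hfun : Prod.snd ∘ (extChartAt (𝓘(ℝ, E₁).prod 𝓘(ℝ, E₂)) (x, y)).symm
      = (extChartAt 𝓘(ℝ, E₂) y).symm ∘ (Prod.snd : E₁ × E₂ → E₂) := by
    rw [extChartAt_prod]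
    rfl
  rw [hfun, hB, mfderiv_eq_fderiv, fderiv_snd] at hA
  exact (congrArg (fun L ↦ L v) hA).symm

theorem coordTensor_warpedTensor (h₁ : TensorField02 𝓘(ℝ, E₁) M₁) (f : M₁ → ℝ)
    (h₂ : TensorField02 𝓘(ℝ, E₂) M₂) {x : M₁} {y : M₂} {e : E₁ × E₂}
    (he₁ : e.1 ∈ (extChartAt 𝓘(ℝ, E₁) x).target) (he₂ : e.2 ∈ (extChartAt 𝓘(ℝ, E₂) y).target)
    (v w : E₁ × E₂) :
    coordTensor (warpedTensor h₁ f h₂) (x, y) e v w = coordTensor h₁ x e.1 v.1 w.1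
      + f ((extChartAt 𝓘(ℝ, E₁) x).symm e.1) * coordTensor h₂ y e.2 v.2 w.2 := by
  have hpt : (extChartAt (𝓘(ℝ, E₁).prod 𝓘(ℝ, E₂)) (x, y)).symm e
      = ((extChartAt 𝓘(ℝ, E₁) x).symm e.1, (extChartAt 𝓘(ℝ, E₂) y).symm e.2) := by
    rw [extChartAt_prod]
    rfl
  have key₁ : ∀ (z z' : M₁) (u u' t t' : E₁), z = z' → u = u' → t = t' →
      h₁ z u t = h₁ z' u' t' := by
    rintro z _ u _ t _ rfl rfl rfl
    rfl
  have key₂ : ∀ (z z' : M₂) (u u' t t' : E₂), z = z' → u = u' → t = t' →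
      h₂ z u t = h₂ z' u' t' := by
    rintro z _ u _ t _ rfl rfl rfl
    rfl
  refine congrArg₂ (· + ·) ?_ (congrArg₂ (· * ·) (congrArg f (congrArg Prod.fst hpt)) ?_)
  · exact key₁ _ _ _ _ _ _ (congrArg Prod.fst hpt) (mfderiv_fst_chart_symm he₁ he₂ v)
      (mfderiv_fst_chart_symm he₁ he₂ w)
  · exact key₂ _ _ _ _ _ _ (congrArg Prod.snd hpt) (mfderiv_snd_chart_symm he₁ he₂ v)
      (mfderiv_snd_chart_symm he₁ he₂ w)

theorem fderiv_coordTensor_warpedTensor {h₁ : TensorField02 𝓘(ℝ, E₁) M₁} {f : M₁ → ℝ}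
    {h₂ : TensorField02 𝓘(ℝ, E₂) M₂} (hd₁ : ChartDifferentiable h₁) (hd₂ : ChartDifferentiable h₂)
    (hf : ContMDiff 𝓘(ℝ, E₁) 𝓘(ℝ, ℝ) ∞ f) (x : M₁) (y : M₂) (u v w : E₁ × E₂) :
    fderiv ℝ (fun e ↦ coordTensor (warpedTensor h₁ f h₂) (x, y) e v w)
        (extChartAt 𝓘(ℝ, E₁) x x, extChartAt 𝓘(ℝ, E₂) y y) u
      = fderiv ℝ (fun e ↦ coordTensor h₁ x e v.1 w.1) (extChartAt 𝓘(ℝ, E₁) x x) u.1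
        + f x * fderiv ℝ (fun e ↦ coordTensor h₂ y e v.2 w.2) (extChartAt 𝓘(ℝ, E₂) y y) u.2
        + fderiv ℝ (fun e ↦ f ((extChartAt 𝓘(ℝ, E₁) x).symm e)) (extChartAt 𝓘(ℝ, E₁) x x) u.1
          * coordTensor h₂ y (extChartAt 𝓘(ℝ, E₂) y y) v.2 w.2 := by
  set e₀ : E₁ × E₂ := (extChartAt 𝓘(ℝ, E₁) x x, extChartAt 𝓘(ℝ, E₂) y y) with he₀
  have hev : (fun e ↦ coordTensor (warpedTensor h₁ f h₂) (x, y) e v w) =ᶠ[𝓝 e₀]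
      fun e ↦ coordTensor h₁ x e.1 v.1 w.1
        + f ((extChartAt 𝓘(ℝ, E₁) x).symm e.1) * coordTensor h₂ y e.2 v.2 w.2 := by
    have hopen := (isOpen_extChartAt_target (I := 𝓘(ℝ, E₁)) x).prod
      (isOpen_extChartAt_target (I := 𝓘(ℝ, E₂)) y)
    filter_upwards [hopen.mem_nhds (show e₀ ∈ _ from
      ⟨mem_extChartAt_target x, mem_extChartAt_target y⟩)] with e he
    exact coordTensor_warpedTensor h₁ f h₂ he.1 he.2 v w
  have h1 : HasFDerivAt (fun e : E₁ × E₂ ↦ coordTensor h₁ x e.1 v.1 w.1) _ e₀ :=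
    (hd₁ x v.1 w.1).hasFDerivAt.comp (f := Prod.fst) e₀ hasFDerivAt_fst
  have h2 : HasFDerivAt (fun e : E₁ × E₂ ↦ coordTensor h₂ y e.2 v.2 w.2) _ e₀ :=
    (hd₂ y v.2 w.2).hasFDerivAt.comp (f := Prod.snd) e₀ hasFDerivAt_snd
  have h3 : HasFDerivAt (fun e : E₁ × E₂ ↦ f ((extChartAt 𝓘(ℝ, E₁) x).symm e.1)) _ e₀ :=
    ((contDiffAt_comp_chart_symm hf x).differentiableAt
      (by simp)).hasFDerivAt.comp (f := Prod.fst) e₀ hasFDerivAt_fst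
  rw [hev.fderiv_eq, (h1.fun_add (h3.fun_mul h2)).fderiv]
  have hx : f ((extChartAt 𝓘(ℝ, E₁) x).symm (extChartAt 𝓘(ℝ, E₁) x x)) = f x :=
    congrArg f (extChartAt_to_inv x)
  simp only [add_apply, smul_apply, smul_eq_mul, ContinuousLinearMap.comp_apply,
    ContinuousLinearMap.coe_fst', ContinuousLinearMap.coe_snd', he₀, hx]
  ring

theorem accelCovector_warpedTensor {h₁ : TensorField02 𝓘(ℝ, E₁) M₁} {f : M₁ → ℝ}
    {h₂ : TensorField02 𝓘(ℝ, E₂) M₂} (hd₁ : ChartDifferentiable h₁) (hd₂ : ChartDifferentiable h₂)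
    (hf : ContMDiff 𝓘(ℝ, E₁) 𝓘(ℝ, ℝ) ∞ f) {x : M₁} {y : M₂} {c₁ : ℝ → E₁} {c₂ : ℝ → E₂} {t : ℝ}
    (hc₁ : ContDiffAt ℝ ∞ c₁ t) (hc₂ : ContDiffAt ℝ ∞ c₂ t)
    (hx : c₁ t = extChartAt 𝓘(ℝ, E₁) x x) (hy : c₂ t = extChartAt 𝓘(ℝ, E₂) y y)
    (w : E₁ × E₂) :
    accelCovector (warpedTensor h₁ f h₂) (x, y) (fun s ↦ (c₁ s, c₂ s)) t w
      = accelCovector h₁ x c₁ t w.1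
        - fderiv ℝ (fun e ↦ f ((extChartAt 𝓘(ℝ, E₁) x).symm e)) (c₁ t) w.1
          * coordTensor h₂ y (c₂ t) (deriv c₂ t) (deriv c₂ t) / 2
        + (f x * accelCovector h₂ y c₂ t w.2
          + fderiv ℝ (fun e ↦ f ((extChartAt 𝓘(ℝ, E₁) x).symm e)) (c₁ t) (deriv c₁ t)
            * coordTensor h₂ y (c₂ t) (deriv c₂ t) w.2) := by
  have e1 : deriv (fun s ↦ (c₁ s, c₂ s)) =ᶠ[𝓝 t] fun s ↦ (deriv c₁ s, deriv c₂ s) := by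
    filter_upwards [((hc₁.of_le (by simp : (1 : WithTop ℕ∞) ≤ ∞)).eventually (by simp)),
      ((hc₂.of_le (by simp : (1 : WithTop ℕ∞) ≤ ∞)).eventually (by simp))] with s h1 h2
    exact ((h1.differentiableAt (by simp)).hasDerivAt.prodMk
      (h2.differentiableAt (by simp)).hasDerivAt).deriv
  have e2 : deriv (deriv fun s ↦ (c₁ s, c₂ s)) t = (deriv (deriv c₁) t, deriv (deriv c₂) t) := by
    rw [e1.deriv_eq]
    exact (((hc₁.derivWithin (m := ∞) le_rfl).differentiableAt (by simp)).hasDerivAt.prodMk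
      ((hc₂.derivWithin (m := ∞) le_rfl).differentiableAt (by simp)).hasDerivAt).deriv
  have e3 : f ((extChartAt 𝓘(ℝ, E₁) x).symm (extChartAt 𝓘(ℝ, E₁) x x)) = f x :=
    congrArg f (extChartAt_to_inv x)
  rw [accelCovector, accelCovector, accelCovector, e1.self_of_nhds, e2, christoffelFirst_diag,
    christoffelFirst_diag, christoffelFirst_diag, hx, hy,
    fderiv_coordTensor_warpedTensor hd₁ hd₂ hf, fderiv_coordTensor_warpedTensor hd₁ hd₂ hf,
    coordTensor_warpedTensor h₁ f h₂ (mem_extChartAt_target x) (mem_extChartAt_target y), e3]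
  ring

/-- The geodesic equation of a warped product, split into its two components. -/
theorem isGeodesicOn_warpedTensor_iff {h₁ : TensorField02 𝓘(ℝ, E₁) M₁} {f : M₁ → ℝ}
    {h₂ : TensorField02 𝓘(ℝ, E₂) M₂} (hd₁ : ChartDifferentiable h₁) (hd₂ : ChartDifferentiable h₂)
    (hf : ContMDiff 𝓘(ℝ, E₁) 𝓘(ℝ, ℝ) ∞ f) {γ : ℝ → M₁} {τ : ℝ → M₂}
    (hγ : ContMDiff 𝓘(ℝ, ℝ) 𝓘(ℝ, E₁) ∞ γ) (hτ : ContMDiff 𝓘(ℝ, ℝ) 𝓘(ℝ, E₂) ∞ τ)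
    {s : Set ℝ} (hs : UniqueDiffOn ℝ s) :
    IsGeodesicOn (warpedTensor h₁ f h₂) (fun t ↦ (γ t, τ t)) s ↔ ∀ t ∈ s,
      (∀ w, accelCovector h₁ (γ t) (fun t' ↦ extChartAt 𝓘(ℝ, E₁) (γ t) (γ t')) t w
        = fderiv ℝ (fun e ↦ f ((extChartAt 𝓘(ℝ, E₁) (γ t)).symm e))
            (extChartAt 𝓘(ℝ, E₁) (γ t) (γ t)) w * speedSq h₂ τ t / 2) ∧
      (∀ w, f (γ t) * accelCovector h₂ (τ t) (fun t' ↦ extChartAt 𝓘(ℝ, E₂) (τ t) (τ t')) t w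
        + fderiv ℝ (fun e ↦ f ((extChartAt 𝓘(ℝ, E₁) (γ t)).symm e))
            (extChartAt 𝓘(ℝ, E₁) (γ t) (γ t))
            (deriv (fun t' ↦ extChartAt 𝓘(ℝ, E₁) (γ t) (γ t')) t)
          * coordTensor h₂ (τ t) (extChartAt 𝓘(ℝ, E₂) (τ t) (τ t))
            (deriv (fun t' ↦ extChartAt 𝓘(ℝ, E₂) (τ t) (τ t')) t) w = 0) := by
  rw [isGeodesicOn_iff_of_contMDiff _ (hγ.prodMk hτ) hs]
  refine forall₂_congr fun t _ ↦ ?_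
  rw [speedSq_eq_coordTensor h₂ hτ (mem_chart_source E₂ (τ t))]
  have hchart : (fun t' ↦ extChartAt (𝓘(ℝ, E₁).prod 𝓘(ℝ, E₂)) (γ t, τ t) (γ t', τ t'))
      = fun t' ↦ (extChartAt 𝓘(ℝ, E₁) (γ t) (γ t'), extChartAt 𝓘(ℝ, E₂) (τ t) (τ t')) := by
    funext t'
    rw [extChartAt_prod]
    rfl
  have hmain : ∀ w : E₁ × E₂, _ := accelCovector_warpedTensor hd₁ hd₂ hf (t := t)
    (contDiffAt_chart_comp hγ (mem_chart_source E₁ (γ t)))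
    (contDiffAt_chart_comp hτ (mem_chart_source E₂ (τ t))) rfl rfl
  simp only [hchart, hmain]
  constructor
  · intro h
    refine ⟨fun w ↦ ?_, fun w ↦ ?_⟩
    -- Covectors on the product split: testing on `(w, 0)` and on `(0, w)` kills every term of the
    -- other component.
    · have := h (w, 0)
      simp only [accelCovector, christoffelFirst_diag, coordTensor_zero_right, fderiv_fun_const,
        Pi.zero_apply, zero_apply, map_zero] at this ⊢
      linarith
    · have := h (0, w)
      simp only [accelCovector, christoffelFirst_diag, coordTensor_zero_right, fderiv_fun_const,
        Pi.zero_apply, zero_apply, map_zero] at this ⊢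
      linarith
  · rintro ⟨ha, hb⟩ w
    linarith [ha w.1, hb w.2]

end Product

/-! ### Speed under reparametrization and conservation of energy. -/

section Curves

variable {E : Type*} [NormedAddCommGroup E] [NormedSpace ℝ E]
  {M : Type*} [TopologicalSpace M] [ChartedSpace E M] [IsManifold 𝓘(ℝ, E) ∞ M]

theorem speedSq_comp (h : TensorField02 𝓘(ℝ, E) M) {γ : ℝ → M}
    (hγ : ContMDiff 𝓘(ℝ, ℝ) 𝓘(ℝ, E) ∞ γ) {σ : ℝ → ℝ} (hσ : ContDiff ℝ ∞ σ) (t : ℝ) :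
    speedSq h (fun s ↦ γ (σ s)) t = deriv σ t ^ 2 * speedSq h γ (σ t) := by
  have hmem : γ (σ t) ∈ (chartAt E (γ (σ t))).source := mem_chart_source E _
  rw [speedSq_eq_coordTensor h (γ := fun s ↦ γ (σ s)) (hγ.comp hσ.contMDiff) hmem,
    speedSq_eq_coordTensor h hγ hmem,
    (deriv_comp_reparam (c := fun s ↦ extChartAt 𝓘(ℝ, E) (γ (σ t)) (γ s)) hσ
      (contDiffAt_chart_comp hγ hmem)).1, coordTensor_smul_left, coordTensor_smul_right]
  ring

theorem hasDerivAt_comp_curve {f : M → ℝ} (hf : ContMDiff 𝓘(ℝ, E) 𝓘(ℝ, ℝ) ∞ f) {γ : ℝ → M}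
    (hγ : ContMDiff 𝓘(ℝ, ℝ) 𝓘(ℝ, E) ∞ γ) (t : ℝ) :
    HasDerivAt (fun s ↦ f (γ s))
      (fderiv ℝ (fun e ↦ f ((extChartAt 𝓘(ℝ, E) (γ t)).symm e)) (extChartAt 𝓘(ℝ, E) (γ t) (γ t))
        (deriv (fun s ↦ extChartAt 𝓘(ℝ, E) (γ t) (γ s)) t)) t := by
  have h1 := ((contDiffAt_comp_chart_symm hf (γ t)).differentiableAt (by simp)).hasFDerivAt
  have h2 := ((contDiffAt_chart_comp hγ (mem_chart_source E (γ t))).differentiableAt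
    (by simp)).hasDerivAt
  refine (h1.comp_hasDerivAt (f := fun s ↦ extChartAt 𝓘(ℝ, E) (γ t) (γ s)) t
    h2).congr_of_eventuallyEq ?_
  filter_upwards [hγ.continuous.continuousAt.preimage_mem_nhds
    (extChartAt_source_mem_nhds (I := 𝓘(ℝ, E)) (γ t))] with s hs
  exact congrArg f ((extChartAt 𝓘(ℝ, E) (γ t)).left_inv hs).symm

theorem speedSq_eq_of_accelCovector_eq_zero [FiniteDimensional ℝ E] {h : TensorField02 𝓘(ℝ, E) M}
    (hsymm : ∀ x v w, h x v w = h x w v) (hdiff : ChartDifferentiable h)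
    {γ : ℝ → M} (hγ : ContMDiff 𝓘(ℝ, ℝ) 𝓘(ℝ, E) ∞ γ)
    (hacc : ∀ t w, accelCovector h (γ t) (fun s ↦ extChartAt 𝓘(ℝ, E) (γ t) (γ s)) t w = 0)
    (t : ℝ) : speedSq h γ t = speedSq h γ 0 := by
  have hd : ∀ s, HasDerivAt (speedSq h γ) 0 s := fun s ↦ by
    simpa only [hacc, mul_zero] using hasDerivAt_speedSq hsymm hdiff hγ s
  exact is_const_of_deriv_eq_zero (fun s ↦ (hd s).differentiableAt) (fun s ↦ (hd s).deriv) t 0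

end Curves

/-! ### Primitives and diffeomorphisms of the unit interval. -/

section Reparametrization

theorem isReparam_of_contDiff {φ φ' : ℝ → ℝ} (hφ : ContDiff ℝ ∞ φ) (h0 : φ 0 = 0) (h1 : φ 1 = 1)
    (hd : ∀ t, HasDerivAt φ (φ' t) t) (hpos : ∀ t, 0 < φ' t) : IsReparam φ φ' := by
  have hmono : StrictMono φ := strictMono_of_hasDerivAt_pos hd hpos
  refine ⟨h0, h1, ⟨?_, hmono.injective.injOn, ?_⟩, hφ.contDiffOn,
    fun t _ ↦ (hd t).hasDerivWithinAt, fun t _ ↦ (hpos t).ne'⟩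
  · intro t ht
    exact ⟨h0 ▸ hmono.monotone ht.1, h1 ▸ hmono.monotone ht.2⟩
  · have := intermediate_value_Icc (zero_le_one' ℝ) hφ.continuous.continuousOn
    rwa [h0, h1] at this

theorem hasDerivAt_primitive {q : ℝ → ℝ} (hq : Continuous q) (s : ℝ) :
    HasDerivAt (fun s ↦ ∫ u in (0 : ℝ)..s, q u) (q s) s :=
  intervalIntegral.integral_hasDerivAt_right (hq.intervalIntegrable _ _)
    hq.aestronglyMeasurable.stronglyMeasurableAtFilter hq.continuousAt

theorem contDiff_primitive {q : ℝ → ℝ} (hq : ContDiff ℝ ∞ q) :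
    ContDiff ℝ ∞ (fun s ↦ ∫ u in (0 : ℝ)..s, q u) := by
  rw [contDiff_infty_iff_deriv]
  refine ⟨fun s ↦ (hasDerivAt_primitive hq.continuous s).differentiableAt, ?_⟩
  rwa [funext fun s ↦ (hasDerivAt_primitive hq.continuous s).deriv]

theorem primitive_strictMono {q : ℝ → ℝ} (hq : Continuous q) (hpos : ∀ s, 0 < q s) :
    StrictMono (fun s ↦ ∫ u in (0 : ℝ)..s, q u) :=
  strictMono_of_hasDerivAt_pos (hasDerivAt_primitive hq) hpos

theorem primitive_surjective {q : ℝ → ℝ} (hq : Continuous q) {c : ℝ} (hc : 0 < c)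
    (hqc : ∀ s, c ≤ q s) : Function.Surjective (fun s ↦ ∫ u in (0 : ℝ)..s, q u) := by
  have hcont : Continuous (fun s ↦ ∫ u in (0 : ℝ)..s, q u) :=
    continuous_iff_continuousAt.2 fun s ↦ (hasDerivAt_primitive hq s).continuousAt
  -- Since `q ≥ c`, the primitive minus `c s` is monotone, so the primitive dominates a line of
  -- positive slope at both ends.
  have hmono : Monotone (fun s ↦ (∫ u in (0 : ℝ)..s, q u) - c * s) := by
    refine monotone_of_hasDerivAt_nonneg (f' := fun s ↦ q s - c)
      (fun s ↦ ?_) (fun s ↦ sub_nonneg.2 (hqc s))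
    simpa using (hasDerivAt_primitive hq s).fun_sub ((hasDerivAt_id s).const_mul c)
  refine hcont.surjective ?_ ?_
  · refine tendsto_atTop_mono' _ ?_ (tendsto_id.const_mul_atTop hc)
    filter_upwards [eventually_ge_atTop 0] with s hs
    have := hmono hs
    simp only [intervalIntegral.integral_same, mul_zero, sub_zero] at this
    simpa using this
  · refine tendsto_atBot_mono' _ ?_ (tendsto_id.const_mul_atBot hc)
    filter_upwards [eventually_le_atBot 0] with s hs
    have := hmono hs
    simp only [intervalIntegral.integral_same, mul_zero, sub_zero] at this
    simpa using this

/-- Solution of `q(φ) φ' = a`, `φ 0 = 0`, `φ 1 = 1`. -/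
theorem exists_reparam {q : ℝ → ℝ} (hq : ContDiff ℝ ∞ q) {c : ℝ} (hc : 0 < c)
    (hqc : ∀ s, c ≤ q s) :
    ∃ (φ : ℝ → ℝ) (a : ℝ), 0 < a ∧ ContDiff ℝ ∞ φ ∧ φ 0 = 0 ∧ φ 1 = 1 ∧
      ∀ t, HasDerivAt φ (a * (q (φ t))⁻¹) t := by
  set F : ℝ → ℝ := fun s ↦ ∫ u in (0 : ℝ)..s, q u with hF
  have hpos : ∀ s, 0 < q s := fun s ↦ hc.trans_le (hqc s)
  have hmono : StrictMono F := primitive_strictMono hq.continuous hpos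
  have hF0 : F 0 = 0 := intervalIntegral.integral_same
  let e : ℝ ≃o ℝ := hmono.orderIsoOfSurjective F (primitive_surjective hq.continuous hc hqc)
  have he : ∀ s, e s = F s := fun _ ↦ rfl
  let p : OpenPartialHomeomorph ℝ ℝ := e.toHomeomorph.toOpenPartialHomeomorph
  have hsm : ContDiff ℝ ∞ e.symm := contDiff_iff_contDiffAt.2 fun y ↦
    p.contDiffAt_symm_deriv (f₀' := q (e.symm y)) (hpos _).ne' (mem_univ y)
      (hasDerivAt_primitive hq.continuous _) (contDiff_primitive hq).contDiffAt
  have hd : ∀ y, HasDerivAt e.symm (q (e.symm y))⁻¹ y := fun y ↦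
    HasDerivAt.of_local_left_inverse hsm.continuous.continuousAt
      (hasDerivAt_primitive hq.continuous _) (hpos _).ne'
      (Eventually.of_forall fun z ↦ e.apply_symm_apply z)
  -- Separation of variables: the equation integrates to `F (φ t) = a t`, and `φ 1 = 1` forces `a =
  -- F 1`.
  refine ⟨fun t ↦ e.symm (F 1 * t), F 1, hF0 ▸ hmono one_pos,
    hsm.comp (contDiff_const.mul contDiff_id), ?_, ?_, fun t ↦ ?_⟩
  · change e.symm (F 1 * 0) = 0
    rw [mul_zero, e.symm_apply_eq, he, hF0]
  · change e.symm (F 1 * 1) = 1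
    rw [mul_one, ← he, e.symm_apply_apply]
  · have h2 : HasDerivAt (fun t : ℝ ↦ F 1 * t) (F 1) t := by
      simpa using (hasDerivAt_id t).const_mul (F 1)
    refine ((hd (F 1 * t)).comp t h2).congr_deriv (mul_comm _ _)

end Reparametrization

theorem contMDiff_conformalFactor {E M : Type*} [NormedAddCommGroup E] [NormedSpace ℝ E]
    [TopologicalSpace M] [ChartedSpace E M] {k : M → ℝ} {r : ℝ}
    (hk : ContMDiff 𝓘(ℝ, E) 𝓘(ℝ, ℝ) ∞ k) (hk₀ : ∀ x, 0 < k x) :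
    ContMDiff 𝓘(ℝ, E) 𝓘(ℝ, ℝ) ∞ (fun x ↦ 1 / k x + r) := by
  intro x
  have h : ContDiffAt ℝ ∞ (fun y : ℝ ↦ 1 / y + r) (k x) :=
    (contDiffAt_const.div contDiffAt_id (hk₀ x).ne').add contDiffAt_const
  exact h.contMDiffAt.comp x (hk x)

/-! ### Geodesics of the product metric and of the warped metric. -/

section Main

variable {E₁ E₂ : Type*}
  [NormedAddCommGroup E₁] [NormedSpace ℝ E₁] [NormedAddCommGroup E₂] [NormedSpace ℝ E₂]
  {M₁ M₂ : Type*}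
  [TopologicalSpace M₁] [ChartedSpace E₁ M₁] [IsManifold 𝓘(ℝ, E₁) ∞ M₁]
  [TopologicalSpace M₂] [ChartedSpace E₂ M₂] [IsManifold 𝓘(ℝ, E₂) ∞ M₂]
  {g₁ : Bundle.ContMDiffRiemannianMetric 𝓘(ℝ, E₁) ∞ E₁ (fun x : M₁ ↦ TangentSpace 𝓘(ℝ, E₁) x)}
  {g₂ : Bundle.ContMDiffRiemannianMetric 𝓘(ℝ, E₂) ∞ E₂ (fun x : M₂ ↦ TangentSpace 𝓘(ℝ, E₂) x)}
  {k : M₁ → ℝ} {r : ℝ}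

theorem chartDifferentiable_conformalMetric (hk : ContMDiff 𝓘(ℝ, E₁) 𝓘(ℝ, ℝ) ∞ k)
    (hk₀ : ∀ x, 0 < k x) : ChartDifferentiable (conformalMetric g₁ k r) :=
  chartDifferentiable_conformal (chartDifferentiable_riemTensor g₁)
    (contMDiff_conformalFactor hk hk₀)

/-- A curve in the product is a geodesic of `G_r + g₂` iff its components are geodesics of `G_r`
and `g₂`. -/
theorem isGeodesicOn_productMetric_iff (hk : ContMDiff 𝓘(ℝ, E₁) 𝓘(ℝ, ℝ) ∞ k)
    (hk₀ : ∀ x, 0 < k x) {μ : ℝ → M₁} {ν : ℝ → M₂}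
    (hμ : ContMDiff 𝓘(ℝ, ℝ) 𝓘(ℝ, E₁) ∞ μ) (hν : ContMDiff 𝓘(ℝ, ℝ) 𝓘(ℝ, E₂) ∞ ν)
    {s : Set ℝ} (hs : UniqueDiffOn ℝ s) :
    IsGeodesicOn (productMetric g₁ g₂ k r) (fun t ↦ (μ t, ν t)) s ↔ ∀ t ∈ s,
      (∀ w, accelCovector (conformalMetric g₁ k r) (μ t)
        (fun t' ↦ extChartAt 𝓘(ℝ, E₁) (μ t) (μ t')) t w = 0) ∧
      (∀ w, accelCovector (riemTensor g₂) (ν t)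
        (fun t' ↦ extChartAt 𝓘(ℝ, E₂) (ν t) (ν t')) t w = 0) := by
  rw [productMetric, isGeodesicOn_warpedTensor_iff (chartDifferentiable_conformalMetric hk hk₀)
    (chartDifferentiable_riemTensor g₂) contMDiff_const hμ hν hs]
  simp

/-- The reparametrization of the components of a geodesic of `G_r + g₂` that makes it a geodesic of
`g₁ - k g₂`. -/
theorem isGeodesicOn_warpedMetric_comp (hk : ContMDiff 𝓘(ℝ, E₁) 𝓘(ℝ, ℝ) ∞ k)
    (hk₀ : ∀ x, 0 < k x) {μ : ℝ → M₁} {ν : ℝ → M₂}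
    (hμ : ContMDiff 𝓘(ℝ, ℝ) 𝓘(ℝ, E₁) ∞ μ) (hν : ContMDiff 𝓘(ℝ, ℝ) 𝓘(ℝ, E₂) ∞ ν)
    (hμg : ∀ t w, accelCovector (conformalMetric g₁ k r) (μ t)
        (fun t' ↦ extChartAt 𝓘(ℝ, E₁) (μ t) (μ t')) t w = 0)
    (hνg : ∀ t w, accelCovector (riemTensor g₂) (ν t)
        (fun t' ↦ extChartAt 𝓘(ℝ, E₂) (ν t) (ν t')) t w = 0)
    {A B p m : ℝ} (hA : ∀ t, speedSq (conformalMetric g₁ k r) μ t = A)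
    (hB : ∀ t, speedSq (riemTensor g₂) ν t = B) (hpm : p ^ 2 * A = m ^ 2 * B)
    {σ ρ : ℝ → ℝ} (hσ : ContDiff ℝ ∞ σ) (hρ : ContDiff ℝ ∞ ρ)
    (hσ' : ∀ t, deriv σ t = p * (1 / k (μ (σ t)) + r)) (hρ' : ∀ t, deriv ρ t = m / k (μ (σ t)))
    {s : Set ℝ} (hs : UniqueDiffOn ℝ s) :
    IsGeodesicOn (warpedMetric g₁ g₂ k) (fun t ↦ (μ (σ t), ν (ρ t))) s := by
  have hγ : ContMDiff 𝓘(ℝ, ℝ) 𝓘(ℝ, E₁) ∞ (fun t ↦ μ (σ t)) := hμ.comp hσ.contMDiff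
  have hτ : ContMDiff 𝓘(ℝ, ℝ) 𝓘(ℝ, E₂) ∞ (fun t ↦ ν (ρ t)) := hν.comp hρ.contMDiff
  have hnk : ContMDiff 𝓘(ℝ, E₁) 𝓘(ℝ, ℝ) ∞ (fun x ↦ -k x) := hk.neg
  have hθ : ContMDiff 𝓘(ℝ, E₁) 𝓘(ℝ, ℝ) ∞ (fun x ↦ 1 / k x + r) :=
    contMDiff_conformalFactor hk hk₀
  rw [warpedMetric, isGeodesicOn_warpedTensor_iff (chartDifferentiable_riemTensor g₁)
    (chartDifferentiable_riemTensor g₂) hnk hγ hτ hs]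
  intro t _
  set x : M₁ := μ (σ t) with hx
  set e : E₁ := extChartAt 𝓘(ℝ, E₁) x x with he
  set K : E₁ →L[ℝ] ℝ := fderiv ℝ (fun e ↦ k ((extChartAt 𝓘(ℝ, E₁) x).symm e)) e with hK
  have hkd : HasFDerivAt (fun e ↦ k ((extChartAt 𝓘(ℝ, E₁) x).symm e)) K e :=
    ((contDiffAt_comp_chart_symm hk x).differentiableAt (by simp)).hasFDerivAt
  have hkx : k ((extChartAt 𝓘(ℝ, E₁) x).symm e) = k x := congrArg k (extChartAt_to_inv x)
  have hkpos := hk₀ x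
  have hnkd : fderiv ℝ (fun e ↦ -k ((extChartAt 𝓘(ℝ, E₁) x).symm e)) e = -K := hkd.fun_neg.fderiv
  have hθd : ∀ w, fderiv ℝ (fun e ↦ 1 / k ((extChartAt 𝓘(ℝ, E₁) x).symm e) + r) e w
      = -K w / k x ^ 2 := fun w ↦ by
    have h1 : HasDerivAt (fun y : ℝ ↦ 1 / y + r) (-(k x ^ 2)⁻¹) (k x) := by
      simpa only [one_div] using (hasDerivAt_inv hkpos.ne').add_const r
    rw [← hkx] at h1
    have h2 := (h1.comp_hasFDerivAt e hkd).fderiv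
    have h3 : fderiv ℝ (fun e ↦ 1 / k ((extChartAt 𝓘(ℝ, E₁) x).symm e) + r) e
      = -(k ((extChartAt 𝓘(ℝ, E₁) x).symm e) ^ 2)⁻¹ • K := h2
    rw [h3, hkx]
    simp only [smul_apply, smul_eq_mul]
    field_simp
  have hc : ContDiffAt ℝ ∞ (fun s ↦ extChartAt 𝓘(ℝ, E₁) x (μ s)) (σ t) :=
    contDiffAt_chart_comp hμ (mem_chart_source E₁ x)
  have hd : ContDiffAt ℝ ∞ (fun s ↦ extChartAt 𝓘(ℝ, E₂) (ν (ρ t)) (ν s)) (ρ t) :=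
    contDiffAt_chart_comp hν (mem_chart_source E₂ _)
  set c' : E₁ := deriv (fun s ↦ extChartAt 𝓘(ℝ, E₁) x (μ s)) (σ t) with hc'
  set d' : E₂ := deriv (fun s ↦ extChartAt 𝓘(ℝ, E₂) (ν (ρ t)) (ν s)) (ρ t) with hd'
  have hcγ : deriv (fun s ↦ extChartAt 𝓘(ℝ, E₁) x (μ (σ s))) t = deriv σ t • c' :=
    (deriv_comp_reparam hσ hc).1
  have hdτ : deriv (fun s ↦ extChartAt 𝓘(ℝ, E₂) (ν (ρ t)) (ν (ρ s))) t = deriv ρ t • d' :=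
    (deriv_comp_reparam hρ hd).1
  have hkγ : HasDerivAt (fun s ↦ k (μ (σ s))) (deriv σ t * K c') t := by
    have := hasDerivAt_comp_curve hk hγ t
    rw [hcγ, map_smul, smul_eq_mul] at this
    exact this
  have hσ'' : deriv (deriv σ) t = p * (-(deriv σ t * K c') / k x ^ 2) := by
    conv_lhs => rw [funext hσ']
    have h1 : HasDerivAt (fun y : ℝ ↦ 1 / y + r) (-(k x ^ 2)⁻¹) (k x) := by
      simpa only [one_div] using (hasDerivAt_inv hkpos.ne').add_const r
    have h2 := ((h1.comp (h := fun s ↦ k (μ (σ s))) t hkγ).const_mul p).deriv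
    refine Eq.trans h2 ?_
    field_simp
  have hρ'' : deriv (deriv ρ) t = m * (-(deriv σ t * K c') / k x ^ 2) := by
    rw [funext hρ']
    have h2 := ((hkγ.fun_inv hkpos.ne').const_mul m).deriv
    simpa only [div_eq_mul_inv] using h2
  -- The geodesic equation of `G_r` for `μ`, rewritten in terms of `g₁` by the conformal formula
  -- with `dθ = -dk / k²`.
  have hG : ∀ w, (1 / k x + r) * accelCovector (riemTensor g₁) x
        (fun s ↦ extChartAt 𝓘(ℝ, E₁) x (μ s)) (σ t) w
      + -K c' / k x ^ 2 * coordTensor (riemTensor g₁) x e c' w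
      - -K w / k x ^ 2 * coordTensor (riemTensor g₁) x e c' c' / 2 = 0 := fun w ↦ by
    have h1 := accelCovector_conformal (chartDifferentiable_riemTensor g₁) hθ (x₀ := x)
      (c := fun s ↦ extChartAt 𝓘(ℝ, E₁) x (μ s)) (t := σ t) rfl w
    have h2 := h1.symm.trans (hμg (σ t) w)
    rw [hθd, hθd] at h2
    exact h2
  have hAx : (1 / k x + r) * coordTensor (riemTensor g₁) x e c' c' = A := by
    have h1 := speedSq_eq_coordTensor (conformalMetric g₁ k r) hμ (t := σ t)
      (mem_chart_source E₁ x)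
    rw [hA] at h1
    rw [h1]
    change _ = (1 / k ((extChartAt 𝓘(ℝ, E₁) x).symm e) + r) *
      coordTensor (riemTensor g₁) x e c' c'
    rw [hkx]
  have hBx : speedSq (riemTensor g₂) (fun t ↦ ν (ρ t)) t = deriv ρ t ^ 2 * B := by
    rw [speedSq_comp _ hν hρ, hB]
  refine ⟨fun w ↦ ?_, fun w ↦ ?_⟩
  -- First component: `σ'' = -p² θ dk(c') / k²` is exactly the tangential term in `p² θ` times `hG`.
  -- What remains is `p² A dk / (2 k²)`, which `p² A = m² B` matches with the warping term.
  · rw [hBx, hnkd, accelCovector_comp (c := fun s ↦ extChartAt 𝓘(ℝ, E₁) x (μ s)) _ _ hσ hc w,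
      hσ'', hρ', hσ']
    change (p * (1 / k x + r)) ^ 2 * _ + p * (-(p * (1 / k x + r) * K c') / k x ^ 2)
      * coordTensor (riemTensor g₁) x e c' w = -K w * ((m / k x) ^ 2 * B) / 2
    have hkey : -K w * ((m / k x) ^ 2 * B) / 2 = -K w / k x ^ 2 * (p ^ 2 * A) / 2 := by
      rw [hpm]
      field_simp
    rw [hkey, ← hAx]
    linear_combination p ^ 2 * (1 / k x + r) * hG w
  -- Second component: as `ν` is a geodesic, only tangential terms survive, and they cancel because
  -- `k ρ' = m` is constant.
  · rw [hnkd, accelCovector_comp (c := fun s ↦ extChartAt 𝓘(ℝ, E₂) (ν (ρ t)) (ν s)) _ _ hρ hd w,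
      hcγ, hdτ, hνg, hρ'', coordTensor_smul_left, hρ', map_smul, smul_eq_mul]
    change -k x * (_ + _ * coordTensor (riemTensor g₂) (ν (ρ t)) _ d' w)
      + deriv σ t * (-K c') * (m / k x * coordTensor (riemTensor g₂) (ν (ρ t)) _ d' w) = 0
    field_simp
    ring

end Main

/-- The conformal factor `1 / k + r` is bounded away from zero. -/
theorem exists_pos_le_conformalFactor {X : Type*} {k : X → ℝ} {r : ℝ} (hk₀ : ∀ x, 0 < k x)
    (hr : lowerParam k < r) : ∃ c : ℝ, 0 < c ∧ ∀ x, c ≤ 1 / k x + r := by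
  unfold lowerParam at hr
  split_ifs at hr with hb
  -- Here `1 / k ≥ 1 / sup k`, and positivity of the constant is precisely the lower bound on `r`.
  -- In the unbounded case `r > 0` itself serves.
  · refine ⟨(⨆ x, k x)⁻¹ + r, by linarith, fun x ↦ ?_⟩
    rw [one_div]
    gcongr
    · exact hk₀ x
    · exact le_ciSup hb x
  · exact ⟨r, hr, fun x ↦ by have := one_div_pos.2 (hk₀ x); linarith⟩

/-! ### Positivity of the metric and the speed of constant curves. -/

section Speed

variable {E : Type*} [NormedAddCommGroup E] [NormedSpace ℝ E]
  {M : Type*} [TopologicalSpace M] [ChartedSpace E M] [IsManifold 𝓘(ℝ, E) ∞ M]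
  (g : Bundle.ContMDiffRiemannianMetric 𝓘(ℝ, E) ∞ E (fun x : M ↦ TangentSpace 𝓘(ℝ, E) x))

theorem riemTensor_self_nonneg (x : M) (v : TangentSpace 𝓘(ℝ, E) x) : 0 ≤ riemTensor g x v v := by
  rcases eq_or_ne v 0 with rfl | hv
  · simp
  · exact (g.pos x v hv).le

theorem eq_zero_of_riemTensor_self {x : M} {v : TangentSpace 𝓘(ℝ, E) x}
    (h : riemTensor g x v v = 0) : v = 0 := by
  by_contra hv
  exact (g.pos x v hv).ne' h

omit [IsManifold 𝓘(ℝ, E) ∞ M] in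
theorem speedSq_eq_zero_of_const (h : TensorField02 𝓘(ℝ, E) M) {γ : ℝ → M}
    (hγ : ∀ t, γ t = γ 0) (t : ℝ) : speedSq h γ t = 0 := by
  obtain ⟨x, rfl⟩ : ∃ x, γ = fun _ ↦ x := ⟨γ 0, funext hγ⟩
  rw [speedSq, mfderiv_const]
  exact map_zero _

theorem riemTensor_velocityWithin {γ : ℝ → M} (hγ : ContMDiff 𝓘(ℝ, ℝ) 𝓘(ℝ, E) ∞ γ) {s : Set ℝ}
    (hs : UniqueDiffOn ℝ s) {t : ℝ} (ht : t ∈ s) :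
    g.inner (γ t) (velocityWithin 𝓘(ℝ, E) γ s t) (velocityWithin 𝓘(ℝ, E) γ s t)
      = speedSq (riemTensor g) γ t := by
  rw [velocityWithin, mfderivWithin_eq_mfderiv
    (uniqueMDiffWithinAt_iff_uniqueDiffWithinAt.2 (hs t ht)) (hγ.mdifferentiable (by simp) t)]
  rfl

end Speed

theorem contDiff_const_mul_id (a : ℝ) : ContDiff ℝ ∞ (fun t : ℝ ↦ a * t) :=
  contDiff_const.mul contDiff_id

theorem deriv_mul_left_eq_const (a : ℝ) : deriv (fun t : ℝ ↦ a * t) = fun _ ↦ a := by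
  funext t
  simp

/-! ### Construction of the joining geodesic. -/

section Joining

variable {E₁ E₂ : Type*}
  [NormedAddCommGroup E₁] [NormedSpace ℝ E₁] [NormedAddCommGroup E₂] [NormedSpace ℝ E₂]
  {M₁ M₂ : Type*}
  [TopologicalSpace M₁] [ChartedSpace E₁ M₁] [IsManifold 𝓘(ℝ, E₁) ∞ M₁]
  [TopologicalSpace M₂] [ChartedSpace E₂ M₂] [IsManifold 𝓘(ℝ, E₂) ∞ M₂]
  {g₁ : Bundle.ContMDiffRiemannianMetric 𝓘(ℝ, E₁) ∞ E₁ (fun x : M₁ ↦ TangentSpace 𝓘(ℝ, E₁) x)}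
  {g₂ : Bundle.ContMDiffRiemannianMetric 𝓘(ℝ, E₂) ∞ E₂ (fun x : M₂ ↦ TangentSpace 𝓘(ℝ, E₂) x)}
  {k : M₁ → ℝ} {r : ℝ}

/-- The points `(μ 0, ν 0)` and `(μ α, ν β)` are joined by a Riemannian geodesic as soon as
`(∫₀^α du / (1 + r k(μ u)))² G_r(μ̇, μ̇) = β² g₂(ν̇, ν̇)`. -/
theorem joinedByRiemannianGeodesic_of_sq_eq (hk : ContMDiff 𝓘(ℝ, E₁) 𝓘(ℝ, ℝ) ∞ k)
    (hk₀ : ∀ x, 0 < k x) (hr : ∀ x, 0 < 1 / k x + r) {C : ℝ} (hC : ∀ x, 1 / k x + r ≤ C)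
    {μ : ℝ → M₁} {ν : ℝ → M₂}
    (hμ : ContMDiff 𝓘(ℝ, ℝ) 𝓘(ℝ, E₁) ∞ μ) (hν : ContMDiff 𝓘(ℝ, ℝ) 𝓘(ℝ, E₂) ∞ ν)
    (hμg : ∀ t w, accelCovector (conformalMetric g₁ k r) (μ t)
        (fun t' ↦ extChartAt 𝓘(ℝ, E₁) (μ t) (μ t')) t w = 0)
    (hνg : ∀ t w, accelCovector (riemTensor g₂) (ν t)
        (fun t' ↦ extChartAt 𝓘(ℝ, E₂) (ν t) (ν t')) t w = 0)
    {A B : ℝ} (hA : ∀ t, speedSq (conformalMetric g₁ k r) μ t = A)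
    (hB : ∀ t, speedSq (riemTensor g₂) ν t = B) {α β : ℝ}
    (hαβ : (∫ u in (0 : ℝ)..α, (k (μ u) * (1 / k (μ u) + r))⁻¹) ^ 2 * A = β ^ 2 * B) :
    JoinedByRiemannianGeodesic g₁ g₂ k r (μ 0, ν 0) (μ α, ν β) := by
  have hC0 : 0 < C := (hr (μ 0)).trans_le (hC (μ 0))
  -- The linear rescalings `μ (α t)` and `ν (β t)` are geodesics on `[0, 1]` with the required end
  -- points. They absorb the signs of `α` and `β` and their possible vanishing, so `φ` and `ψ` can
  -- always be increasing.
  have hμα : ContMDiff 𝓘(ℝ, ℝ) 𝓘(ℝ, E₁) ∞ (fun t ↦ μ (α * t)) :=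
    hμ.comp (contDiff_const_mul_id α).contMDiff
  have hνβ : ContMDiff 𝓘(ℝ, ℝ) 𝓘(ℝ, E₂) ∞ (fun t ↦ ν (β * t)) :=
    hν.comp (contDiff_const_mul_id β).contMDiff
  have hkα : ContDiff ℝ ∞ (fun t ↦ k (μ (α * t))) := (hk.comp hμα).contDiff
  have hθα : ContDiff ℝ ∞ (fun t ↦ 1 / k (μ (α * t)) + r) :=
    ((contMDiff_conformalFactor hk hk₀).comp hμα).contDiff
  -- The equation `φ' = a θ` in separated form `θ⁻¹ φ' = a`; the upper bound `C` of `θ` keeps `θ⁻¹`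
  -- away from zero.
  obtain ⟨φ, a, ha, hφ, hφ0, hφ1, hφ'⟩ := exists_reparam
    (q := fun t ↦ (1 / k (μ (α * t)) + r)⁻¹) (hθα.inv fun t ↦ (hr _).ne') (inv_pos.2 hC0)
    (fun t ↦ inv_anti₀ (hr _) (hC _))
  simp only [inv_inv] at hφ'
  have hq : ContDiff ℝ ∞ (fun t ↦ (k (μ (α * t)) * (1 / k (μ (α * t)) + r))⁻¹) :=
    (hkα.mul hθα).inv fun t ↦ (mul_pos (hk₀ _) (hr _)).ne'
  -- As `P' = 1 / (k θ)` and `φ' = a θ`, the derivative of `P ∘ φ` is `a / k`. Dividing by `P 1`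
  -- gives `ψ` with `ψ 1 = 1`, and `b = a / P 1`.
  set P : ℝ → ℝ := fun s ↦ ∫ u in (0 : ℝ)..s, (k (μ (α * u)) * (1 / k (μ (α * u)) + r))⁻¹ with hP
  have hP0 : P 0 = 0 := intervalIntegral.integral_same
  have hP1 : 0 < P 1 := hP0 ▸ primitive_strictMono hq.continuous
    (fun t ↦ inv_pos.2 (mul_pos (hk₀ _) (hr _))) one_pos
  -- The substitution `u ↦ α u` turns the integral from `0` to `α` into `α * P 1`, also for `α = 0`.
  have hPα : (α * P 1) ^ 2 * A = β ^ 2 * B := by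
    rw [← hαβ, hP]
    have := intervalIntegral.mul_integral_comp_mul_left (a := 0) (b := 1) α
      (f := fun u ↦ (k (μ u) * (1 / k (μ u) + r))⁻¹)
    simp only [mul_zero, mul_one] at this
    rw [← this]
  have hψ : ContDiff ℝ ∞ (fun t ↦ P (φ t) / P 1) := ((contDiff_primitive hq).comp hφ).div_const _
  have hψ' : ∀ t, HasDerivAt (fun t ↦ P (φ t) / P 1) (a / P 1 / k (μ (α * φ t))) t := fun t ↦ by
    refine (((hasDerivAt_primitive hq.continuous (φ t)).comp t (hφ' t)).div_const
      (P 1)).congr_deriv ?_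
    have h1 := (hk₀ (μ (α * φ t))).ne'
    have h2 := (hr (μ (α * φ t))).ne'
    generalize 1 / k (μ (α * φ t)) + r = θ at h2 ⊢
    field_simp
  have hd : UniqueDiffOn ℝ (Icc (0 : ℝ) 1) := uniqueDiffOn_Icc zero_lt_one
  have h0 : (0 : ℝ) ∈ Icc (0 : ℝ) 1 := ⟨le_rfl, zero_le_one⟩
  have hσ : ContDiff ℝ ∞ (fun t ↦ α * φ t) := contDiff_const.mul hφ
  have hρ : ContDiff ℝ ∞ (fun t ↦ β * (P (φ t) / P 1)) := contDiff_const.mul hψ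
  -- The balance `p² A = m² B` for the total parameters `σ = α φ` and `ρ = β ψ`, with `p = α a` and
  -- `m = β b`.
  have hab : (α * a) ^ 2 * A = (β * (a / P 1)) ^ 2 * B := by
    have : (β * (a / P 1)) ^ 2 * B = a ^ 2 / P 1 ^ 2 * (β ^ 2 * B) := by ring
    rw [this, ← hPα]
    field_simp
  have hcf : ∀ x, (1 + r * k x) / k x = 1 / k x + r := fun x ↦ by
    have := (hk₀ x).ne'
    field_simp
  refine ⟨fun t ↦ μ (α * φ t), fun t ↦ ν (β * (P (φ t) / P 1)), ⟨?_, fun t ↦ μ (α * t),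
    fun t ↦ ν (β * t), φ, fun t ↦ P (φ t) / P 1, a, a / P 1, ?_, ?_, ?_, fun t _ ↦ rfl,
    fun t _ ↦ rfl, ?_⟩, ?_, ?_⟩
  · refine isGeodesicOn_warpedMetric_comp hk hk₀ hμ hν hμg hνg hA hB hab hσ hρ
      (fun t ↦ ?_) (fun t ↦ ?_) hd
    · exact ((hφ' t).const_mul α).deriv.trans (mul_assoc _ _ _).symm
    · exact ((hψ' t).const_mul β).deriv.trans (mul_div_assoc _ _ _).symm
  · rw [isGeodesicOn_productMetric_iff hk hk₀ hμα hνβ hd]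
    refine fun t _ ↦ ⟨fun w ↦ ?_, fun w ↦ ?_⟩
    · rw [accelCovector_comp (c := fun s ↦ extChartAt 𝓘(ℝ, E₁) (μ (α * t)) (μ s)) _ _
        (contDiff_const_mul_id α) (contDiffAt_chart_comp hμ (mem_chart_source E₁ _)), hμg,
        deriv_mul_left_eq_const, deriv_const]
      ring
    · rw [accelCovector_comp (c := fun s ↦ extChartAt 𝓘(ℝ, E₂) (ν (β * t)) (ν s)) _ _
        (contDiff_const_mul_id β) (contDiffAt_chart_comp hν (mem_chart_source E₂ _)), hνg,
        deriv_mul_left_eq_const, deriv_const]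
      ring
  · refine isReparam_of_contDiff hφ hφ0 hφ1 (fun t ↦ ?_) (fun t ↦ ?_)
    · rw [hcf]
      exact hφ' t
    · rw [hcf]
      exact mul_pos ha (hr _)
  · refine isReparam_of_contDiff hψ ?_ ?_ hψ' (fun t ↦ div_pos (div_pos ha hP1) (hk₀ _))
    · rw [hφ0, hP0, zero_div]
    · rw [hφ1, div_self hP1.ne']
  · rw [riemTensor_velocityWithin g₁ hμα hd h0, riemTensor_velocityWithin g₂ hνβ hd h0, hcf]
    have h1 := speedSq_comp (conformalMetric g₁ k r) hμ (contDiff_const_mul_id α) 0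
    have h2 := speedSq_comp (riemTensor g₂) hν (contDiff_const_mul_id β) 0
    rw [hA, deriv_mul_left_eq_const] at h1
    rw [hB, deriv_mul_left_eq_const] at h2
    have h3 : speedSq (conformalMetric g₁ k r) (fun t ↦ μ (α * t)) 0
      = (1 / k (μ (α * 0)) + r) * speedSq (riemTensor g₁) (fun t ↦ μ (α * t)) 0 := rfl
    rw [mul_assoc, ← h3, h1, h2]
    linear_combination hab
  · simp only [hφ0, hP0, zero_div, mul_zero]
  · simp only [hφ1, div_self hP1.ne', mul_one]

end Joining

end

/-! ### Solving the balance equation for `β` or for `α`. -/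

theorem theorem4p1 {E₁ E₂ : Type*}
    [NormedAddCommGroup E₁] [NormedSpace ℝ E₁] [FiniteDimensional ℝ E₁]
    [NormedAddCommGroup E₂] [NormedSpace ℝ E₂] [FiniteDimensional ℝ E₂]
    {M₁ M₂ : Type*}
    [TopologicalSpace M₁] [ChartedSpace E₁ M₁] [IsManifold 𝓘(ℝ, E₁) ∞ M₁]
    [TopologicalSpace M₂] [ChartedSpace E₂ M₂] [IsManifold 𝓘(ℝ, E₂) ∞ M₂]
    (g₁ : Bundle.ContMDiffRiemannianMetric 𝓘(ℝ, E₁) ∞ E₁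
      (fun x : M₁ ↦ TangentSpace 𝓘(ℝ, E₁) x))
    (g₂ : Bundle.ContMDiffRiemannianMetric 𝓘(ℝ, E₂) ∞ E₂
      (fun x : M₂ ↦ TangentSpace 𝓘(ℝ, E₂) x))
    (k : M₁ → ℝ) (hk : ContMDiff 𝓘(ℝ, E₁) 𝓘(ℝ, ℝ) ∞ k)
    (hk₀ : ∃ k₀ : ℝ, 0 < k₀ ∧ ∀ x, k₀ ≤ k x)
    (r : ℝ) (hr : lowerParam k < r)
    (μ : ℝ → M₁) (ν : ℝ → M₂)
    (hμν : IsGeodesicOn (productMetric g₁ g₂ k r) (fun t ↦ (μ t, ν t)) univ) :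
    (((∀ t, ν t = ν 0) → ∀ t, μ t = μ 0) →
      ∀ α : ℝ, ∃ β : ℝ, 0 ≤ β ∧ (α ≠ 0 → (¬ ∀ t, μ t = μ 0) → 0 < β) ∧
        JoinedByRiemannianGeodesic g₁ g₂ k r (μ 0, ν 0) (μ α, ν β) ∧
        JoinedByRiemannianGeodesic g₁ g₂ k r (μ 0, ν 0) (μ α, ν (-β))) ∧
    (BddAbove (range k) → ((∀ t, μ t = μ 0) → ∀ t, ν t = ν 0) →
      ∀ β : ℝ, ∃ α₁ α₂ : ℝ, 0 ≤ α₁ ∧ α₂ ≤ 0 ∧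
        (β ≠ 0 → (¬ ∀ t, ν t = ν 0) → 0 < α₁ ∧ α₂ < 0) ∧
        JoinedByRiemannianGeodesic g₁ g₂ k r (μ 0, ν 0) (μ α₁, ν β) ∧
        JoinedByRiemannianGeodesic g₁ g₂ k r (μ 0, ν 0) (μ α₂, ν β)) := by
  obtain ⟨k₀, hk₀pos, hk₀⟩ := hk₀
  have hkpos : ∀ x, 0 < k x := fun x ↦ hk₀pos.trans_le (hk₀ x)
  obtain ⟨c, hc, hcle⟩ := exists_pos_le_conformalFactor hkpos hr
  have hθ : ∀ x, 0 < 1 / k x + r := fun x ↦ hc.trans_le (hcle x)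
  have hC : ∀ x, 1 / k x + r ≤ 1 / k₀ + r := fun x ↦ by
    gcongr
    exact hk₀ x
  have hsm := contMDiffOn_univ.1 hμν.1
  have hμ : ContMDiff 𝓘(ℝ, ℝ) 𝓘(ℝ, E₁) ∞ μ := hsm.fst
  have hν : ContMDiff 𝓘(ℝ, ℝ) 𝓘(ℝ, E₂) ∞ ν := hsm.snd
  rw [isGeodesicOn_productMetric_iff hk hkpos hμ hν uniqueDiffOn_univ] at hμν
  have hμg := fun t ↦ (hμν t (mem_univ t)).1
  have hνg := fun t ↦ (hμν t (mem_univ t)).2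
  have hA := speedSq_eq_of_accelCovector_eq_zero
    (fun x v w ↦ congrArg ((1 / k x + r) * ·) (g₁.symm x v w))
    (chartDifferentiable_conformalMetric (r := r) hk hkpos) hμ hμg
  have hB := speedSq_eq_of_accelCovector_eq_zero (fun x v w ↦ g₂.symm x v w)
    (chartDifferentiable_riemTensor g₂) hν hνg
  have hA0 : 0 ≤ speedSq (conformalMetric g₁ k r) μ 0 :=
    mul_nonneg (hθ _).le (riemTensor_self_nonneg g₁ _ _)
  have hB0 : 0 ≤ speedSq (riemTensor g₂) ν 0 := riemTensor_self_nonneg g₂ _ _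
  have hAc : speedSq (conformalMetric g₁ k r) μ 0 = 0 ↔ ∀ t, μ t = μ 0 := by
    refine ⟨fun h t ↦ eq_of_mfderiv_eq_zero hμ (fun s ↦ ?_) t 0,
      fun h ↦ speedSq_eq_zero_of_const _ h 0⟩
    rw [← hA s] at h
    exact eq_zero_of_riemTensor_self g₁ ((mul_eq_zero.1 h).resolve_left (hθ _).ne')
  have hBc : speedSq (riemTensor g₂) ν 0 = 0 ↔ ∀ t, ν t = ν 0 := by
    refine ⟨fun h t ↦ eq_of_mfderiv_eq_zero hν (fun s ↦ ?_) t 0,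
      fun h ↦ speedSq_eq_zero_of_const _ h 0⟩
    rw [← hB s] at h
    exact eq_zero_of_riemTensor_self g₂ h
  have hjoin : ∀ {α β : ℝ}, _ → JoinedByRiemannianGeodesic g₁ g₂ k r (μ 0, ν 0) (μ α, ν β) :=
    fun {α β} h ↦ joinedByRiemannianGeodesic_of_sq_eq hk hkpos hθ hC hμ hν hμg hνg hA hB
      (α := α) (β := β) h
  rw [← hAc, ← hBc]
  -- From here on only the numbers `A, B ≥ 0` matter; they vanish exactly when `μ`, respectively
  -- `ν`, is constant.
  generalize speedSq (conformalMetric g₁ k r) μ 0 = A at *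
  generalize speedSq (riemTensor g₂) ν 0 = B at *
  set q : ℝ → ℝ := fun u ↦ (k (μ u) * (1 / k (μ u) + r))⁻¹ with hq
  have hqpos : ∀ u, 0 < q u := fun u ↦ inv_pos.2 (mul_pos (hkpos _) (hθ _))
  have hqc : Continuous q :=
    ((hk.continuous.comp hμ.continuous).mul
      ((contMDiff_conformalFactor hk hkpos).continuous.comp hμ.continuous)).inv₀
      fun u ↦ (mul_pos (hkpos _) (hθ _)).ne'
  have hmono := primitive_strictMono hqc hqpos
  set F : ℝ → ℝ := fun s ↦ ∫ u in (0 : ℝ)..s, q u with hF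
  have hF0 : F 0 = 0 := intervalIntegral.integral_same
  refine ⟨fun h α ↦ ?_, fun hb h β ↦ ?_⟩
  -- The nonnegative solution of `β² B = F(α)² A`. If `B = 0`, the hypothesis gives `A = 0`, and
  -- both sides vanish.
  · have heq : (|F α| * √(A / B)) ^ 2 * B = F α ^ 2 * A := by
      rw [mul_pow, sq_abs, Real.sq_sqrt (div_nonneg hA0 hB0)]
      rcases eq_or_ne B 0 with hB' | hB'
      · rw [hB', h hB', mul_zero, mul_zero]
      · field_simp
    refine ⟨|F α| * √(A / B), by positivity, fun hα hA' ↦ ?_, hjoin heq.symm, hjoin ?_⟩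
    · have hF' : F α ≠ 0 := fun h' ↦ hα (hmono.injective (h'.trans hF0.symm))
      have hB' : B ≠ 0 := fun h' ↦ hA' (h h')
      have : 0 < A / B := div_pos (hA0.lt_of_ne' hA') (hB0.lt_of_ne' hB')
      positivity
    · rw [neg_sq]
      exact heq.symm
  · obtain ⟨K, hK⟩ := hb
    have hK' : ∀ x, k x ≤ K := fun x ↦ hK (mem_range_self x)
    have hKpos : 0 < K := (hkpos (μ 0)).trans_le (hK' _)
    have hCpos : 0 < 1 / k₀ + r := (hθ (μ 0)).trans_le (hC _)
    -- The bounds `k ≤ K` and `θ ≤ 1 / k₀ + r` keep the integrand of `F` away from zero. For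
    -- unbounded `k` the range of `F` may be bounded.
    have hsurj : Function.Surjective F := primitive_surjective hqc
      (inv_pos.2 (mul_pos hKpos hCpos)) fun u ↦ inv_anti₀ (mul_pos (hkpos _) (hθ _))
        (mul_le_mul (hK' _) (hC _) (hθ _).le hKpos.le)
    have heq : (|β| * √(B / A)) ^ 2 * A = β ^ 2 * B := by
      rw [mul_pow, sq_abs, Real.sq_sqrt (div_nonneg hB0 hA0)]
      rcases eq_or_ne A 0 with hA' | hA'
      · rw [hA', h hA', mul_zero, mul_zero]
      · field_simp
    obtain ⟨α₁, hα₁⟩ := hsurj (|β| * √(B / A))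
    obtain ⟨α₂, hα₂⟩ := hsurj (-(|β| * √(B / A)))
    refine ⟨α₁, α₂, ?_, ?_, fun hβ hB' ↦ ?_, hjoin ?_, hjoin ?_⟩
    -- Signs of `α₁` and `α₂` are read off from their values under the strictly increasing `F`, as
    -- `F 0 = 0`.
    · rw [← hmono.le_iff_le, hF0, hα₁]
      positivity
    · rw [← hmono.le_iff_le, hF0, hα₂, neg_nonpos]
      positivity
    · have hA' : A ≠ 0 := fun h' ↦ hB' (h h')
      have : 0 < B / A := div_pos (hB0.lt_of_ne' hB') (hA0.lt_of_ne' hA')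
      rw [← hmono.lt_iff_lt, ← hmono.lt_iff_lt (b := 0), hF0, hα₁, hα₂, neg_lt_zero, and_self]
      positivity
    · change F α₁ ^ 2 * A = _
      rw [hα₁, heq]
    · change F α₂ ^ 2 * A = _
      rw [hα₂, neg_sq, heq]
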